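/- **Setting.** Let $\nu$ be a finite measure on $\mathbb{Z}$ with $\nu(\{0\})=0$, and let $N$ be a Poisson random measure on $\mathbb{Z}\times[0,1]\times\mathbb{R}$ with intensity $\nu(\mathrm{d}y)\,\mathrm{d}x\,\mathrm{d}s$ (an event of size $y$ occurs at height $x$ and time $s$). Let $A\subseteq[0,1]\times(-\infty,0]$ be a trawl: a Borel set such that (i) for almost every height $x$ the indicator function of the section $\{s:(x,s)\in A\}$ is left-continuous with right limits, and (ii) for every $T\ge 0$ the region $\bigcup_{0\le t\le T}A_t$ has finite Lebesgue measure, where $A_t:=A+(0,t)$ (these conditions ensure that the counts below are finite and càdlàg; they hold for example for $A=\{(x,s):s\le 0,\ 0\le x<e^{\phi s}\}$ with $\phi>0$). Put $$Y_t:=\int_{\mathbb{Z}\times A_t}y\,N(\mathrm{d}y,\mathrm{d}x,\mathrm{d}s),\qquad C^{(y)}_t:=N(\{y\}\times A_t),\qquad t\ge 0,$$ let $\Delta Y_s:=Y_s-Y_{s-}$, and for $y\in\mathbb{Z}\setminus\{0\}$ let $N^{(y)}_t:=\#\{s\in(0,t]:\Delta Y_s=y\}$ (so $N^{(y)}_0=0$).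 For integers $y\ge 1$ and real $T\ge 0$ define $$C^{(y),\mathrm{L}}_{0,T}:=\sup_{t\in[0,T]}\bigl(N^{(-y)}_t-N^{(y)}_t\bigr),\qquad C^{(y),\mathrm{U}}_{0,T}:=\left\lfloor\frac{Y_0-\sum_{y'\ge 1,\,y'\ne y}y'\,C^{(y'),\mathrm{L}}_{0,T}}{y}\right\rfloor .$$ **Proposition (bounds on the initial values).** Assume that the trawl process is non-negative, that is, almost surely $Y_t\ge 0$ for all $t\ge 0$. Then, almost surely, all quantities above are well defined (the integrals defining $Y_t$, $t\ge0$, converge absolutely; $Y$ has left limits at all $t>0$ and finitely many jumps in each $(0,T]$; $C^{(y)}_0<\infty$; and the suprema and the sums in the bounds are finite), and for every integer $y\ge 1$: $$C^{(y),\mathrm{L}}_{0,T}\ \le\ C^{(y)}_0\ \le\ C^{(y),\mathrm{U}}_{0,T}\quad\text{for all }T\ge 0,\qquad\text{and}\qquad \lim_{T\to\infty}C^{(y),\mathrm{L}}_{0,T}=\lim_{T\to\infty}C^{(y),\mathrm{U}}_{0,T}=C^{(y)}_0 .$$ -/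

import Mathlib

open MeasureTheory ProbabilityTheory Filter Topology
open scoped ENNReal

noncomputable section

/-- `N` is a Poisson random measure (Poisson point process) on `E` with intensity measure `Λ`
on the probability space `(Ω, P)`: an `ℕ ∪ {∞}`-valued random measure with Poisson counts and
independent counts on disjoint sets. -/
structure IsPoissonRandomMeasure {Ω E : Type*} [MeasurableSpace Ω] [MeasurableSpace E]
    (N : Ω → Measure E) (Λ : Measure E) (P : Measure Ω) : Prop where
  measurable_apply : ∀ B, MeasurableSet B → Measurable (fun ω => N ω B)
  integer_valued : ∀ ω B, MeasurableSet B → ∃ k : ℕ∞, N ω B = (k : ℝ≥0∞)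
  poisson : ∀ B, MeasurableSet B → Λ B ≠ ⊤ →
    P.map (fun ω => N ω B) = (poissonMeasure (Λ B).toNNReal).map (fun k : ℕ => (k : ℝ≥0∞))
  infinite : ∀ B, MeasurableSet B → Λ B = ⊤ → ∀ᵐ ω ∂P, N ω B = ⊤
  indep : ∀ (n : ℕ) (B : Fin n → Set E), (∀ i, MeasurableSet (B i)) →
    Pairwise (fun i j => Disjoint (B i) (B j)) → iIndepFun (fun i ω => N ω (B i)) P

/-- The intensity measure `ν(dy) dx ds` on (event size `y`) × (height `x ∈ [0,1]`) × (time `s`). -/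
def basisIntensity (ν : Measure ℤ) : Measure (ℤ × ℝ × ℝ) :=
  ν.prod (((volume : Measure ℝ).restrict (Set.Icc 0 1)).prod (volume : Measure ℝ))

/-- The translate `A_t = A + (0, t)`. -/
def trawlAt (A : Set (ℝ × ℝ)) (t : ℝ) : Set (ℝ × ℝ) :=
  {p | (p.1, p.2 - t) ∈ A}

/-- A (general) trawl: a Borel set `A ⊆ [0,1] × (-∞,0]` such that the number of events in the moving
trawl `A_t = A + (0,t)` is a finite càdlàg function of `t`. This consists of two conditions:
at almost every height `x` the indicator function of the section `{s | (x,s) ∈ A}` is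
left-continuous with right limits (that is, `t ↦ 1_A(x, s - t)` is càdlàg for every `s`), and only
an area of finite measure is visited by the trawl during a bounded time interval
(in particular `A` has finite Lebesgue measure). -/
structure IsTrawl (A : Set (ℝ × ℝ)) : Prop where
  measurableSet : MeasurableSet A
  subset : A ⊆ Set.Icc 0 1 ×ˢ Set.Iic 0
  section_regular : ∀ᵐ x ∂(volume : Measure ℝ), ∀ s : ℝ,
    (∀ᶠ u in 𝓝[<] s, ((x, u) ∈ A ↔ (x, s) ∈ A)) ∧
      ((∀ᶠ u in 𝓝[>] s, (x, u) ∈ A) ∨ (∀ᶠ u in 𝓝[>] s, (x, u) ∉ A))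
  finite_swept : ∀ T : ℝ, volume (⋃ t ∈ Set.Icc 0 T, trawlAt A t) < ⊤

/-- The Lévy basis `L(B) = ∫ y N(dy, B)` associated with `N`. -/
def levyBasis {Ω : Type*} (N : Ω → Measure (ℤ × ℝ × ℝ)) (ω : Ω) (B : Set (ℝ × ℝ)) : ℝ :=
  ∫ p in Set.univ ×ˢ B, (p.1 : ℝ) ∂(N ω)

/-- The path `t ↦ Y_t(ω) = L(A_t)(ω)` of the trawl process. -/
def trawlProcess {Ω : Type*} (N : Ω → Measure (ℤ × ℝ × ℝ)) (A : Set (ℝ × ℝ)) (ω : Ω) (t : ℝ) : ℝ :=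
  levyBasis N ω (trawlAt A t)

/-- `C_t^{(y)}`: the number of events of size `y` in the trawl at time `t`. -/
def trawlCount {Ω : Type*} (N : Ω → Measure (ℤ × ℝ × ℝ)) (A : Set (ℝ × ℝ)) (y : ℤ) (ω : Ω)
    (t : ℝ) : ℝ :=
  (N ω ({y} ×ˢ trawlAt A t)).toReal

/-- The jump `ΔY_s = Y_s - Y_{s-}` of a path. -/
def jumpAt (Y : ℝ → ℝ) (s : ℝ) : ℝ := Y s - Function.leftLim Y s

/-- `N_t^{(y)}`: the number of jumps of size `y` of the path `Y` during `(0, t]`. -/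
def jumpCount (Y : ℝ → ℝ) (y : ℤ) (t : ℝ) : ℝ :=
  (Set.ncard {s | s ∈ Set.Ioc 0 t ∧ jumpAt Y s = (y : ℝ)} : ℝ)

/-- The lower bound `sup_{t ∈ [0,T]} (N_t^{(-y)} - N_t^{(y)})`, a functional of the path `Y`. -/
def lowerBound (Y : ℝ → ℝ) (y : ℤ) (T : ℝ) : ℝ :=
  sSup ((fun t => jumpCount Y (-y) t - jumpCount Y y t) '' Set.Icc 0 T)

/-- The upper bound `⌊(Y_0 - ∑_{y' ≥ 1, y' ≠ y} y' * (lower bound for y')) / y⌋`. -/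
def upperBound (Y : ℝ → ℝ) (y : ℤ) (T : ℝ) : ℤ :=
  ⌊(Y 0 - ∑' k : {k : ℤ // 0 < k ∧ k ≠ y}, (k.1 : ℝ) * lowerBound Y k.1 T) / (y : ℝ)⌋

end

/-! Call an event's entry into or exit from the trawl a switch. Almost surely every event that is
ever in the trawl has positive size, and no two events switch at the same time. A jump of `Y` by
`+y` is then the entry of one event of size `y`, and a jump by `-y` is its exit, so the net number
of down-jumps on `(0,t]` equals `C_0 - C_t` (`jumpCount_sub_jumpCount`). Since `C_t ≥ 0`, the
running supremum stays below `C_0`, and it reaches `C_0` as soon as the trawl has once been free of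
events of size `y`. For the upper bound, `Y_0` is a finite sum of `y' * C_0^{(y')}`. Replacing the
other counts by their lower bounds overestimates `y * C_0^{(y)}`, the floor costs nothing because
the count is an integer, and the bound is exact once the finitely many lower bounds involved are.

Three probabilistic facts carry this. Positivity (`ae_sweptSet_pos`): if `ν` charged some `k < 0`
and `A` had positive area, then with positive probability the initial trawl would hold exactly one
event, of size `k`. No common switches (`ae_disjoint_switchTimes`): each event has only countably
many switch times, so once one event and the height of another are fixed, only countably many times
of the latter produce a coincidence; independence on disjoint sets transfers this null set to pairs
of points. Emptiness (`ae_exists_count_eq_zero`): recent parts of widely spaced translates are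
disjoint, hence independent, and each is empty with probability bounded below.

The finite swept area reduces paths on bounded time intervals to finite sums of indicator paths
(`IsCarrier`), after which the argument is deterministic. -/

/-! ### Piecewise constant paths and their jump counts. -/

/-- A piecewise constant càdlàg path on `[0, ∞)`. -/
structure IsStepPath (f : ℝ → ℝ) : Prop where
  right : ∀ t, 0 ≤ t → ∀ᶠ u in 𝓝[>] t, f u = f t
  left : ∀ t, 0 < t → ∃ l, ∀ᶠ u in 𝓝[<] t, f u = l

lemma leftLim_eq_of_eventually {f : ℝ → ℝ} {t l : ℝ} (h : ∀ᶠ u in 𝓝[<] t, f u = l) :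
    Function.leftLim f t = l := by
  refine leftLim_eq_of_tendsto ?_
  exact tendsto_const_nhds.congr' (h.mono fun u hu => hu.symm)

lemma jumpAt_eq_zero_of_eventually {f : ℝ → ℝ} {t c : ℝ} (h : ∀ᶠ u in 𝓝 t, f u = c) :
    jumpAt f t = 0 := by
  rw [jumpAt, leftLim_eq_of_eventually (h.filter_mono nhdsWithin_le_nhds), h.self_of_nhds, sub_self]

lemma eventually_right_jumpAt_eq_zero {f : ℝ → ℝ} {t c : ℝ} (h : ∀ᶠ u in 𝓝[>] t, f u = c) :
    ∀ᶠ u in 𝓝[>] t, jumpAt f u = 0 := by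
  have h2 := eventually_eventually_nhdsWithin.2 h
  filter_upwards [h2, self_mem_nhdsWithin] with u hu hut
  rw [IsOpen.nhdsWithin_eq isOpen_Ioi hut] at hu
  exact jumpAt_eq_zero_of_eventually hu

lemma eventually_left_jumpAt_eq_zero {f : ℝ → ℝ} {t c : ℝ} (h : ∀ᶠ u in 𝓝[<] t, f u = c) :
    ∀ᶠ u in 𝓝[<] t, jumpAt f u = 0 := by
  have h2 := eventually_eventually_nhdsWithin.2 h
  filter_upwards [h2, self_mem_nhdsWithin] with u hu hut
  rw [IsOpen.nhdsWithin_eq isOpen_Iio hut] at hu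
  exact jumpAt_eq_zero_of_eventually hu

/-- A set of reals whose points do not accumulate in a compact set is finite there. -/
lemma IsCompact.finite_of_isolated {K J : Set ℝ} (hK : IsCompact K)
    (h : ∀ t ∈ K, ∀ᶠ u in 𝓝[K \ {t}] t, u ∉ J) : (K ∩ J).Finite := by
  refine hK.induction_on (p := fun s => (s ∩ J).Finite) (by simp)
    (fun s t hst ht => ht.subset (Set.inter_subset_inter_left _ hst))
    (fun s t hs ht => by rw [Set.union_inter_distrib_right]; exact hs.union ht) ?_
  intro t ht
  -- This neighbourhood of `t` consists of `t` and points outside `J`, so it meets `J` at most in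
  -- `t`.
  refine ⟨insert t ({u | u ∉ J} ∩ (K \ {t}) ), ?_, ?_⟩
  · have h1 := h t ht
    rw [Filter.Eventually, mem_nhdsWithin_iff_exists_mem_nhds_inter] at h1
    obtain ⟨v, hv, hvs⟩ := h1
    rw [mem_nhdsWithin_iff_exists_mem_nhds_inter]
    refine ⟨v, hv, fun u hu => ?_⟩
    by_cases hut : u = t
    · exact Or.inl hut
    · exact Or.inr ⟨hvs ⟨hu.1, hu.2, hut⟩, hu.2, hut⟩
  · refine (Set.finite_singleton t).subset ?_
    rintro u ⟨hu | hu, huJ⟩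
    · exact hu
    · exact absurd huJ hu.1

namespace IsStepPath

variable {f Y : ℝ → ℝ}

lemma left_leftLim (hf : IsStepPath f) {t : ℝ} (ht : 0 < t) :
    ∀ᶠ u in 𝓝[<] t, f u = Function.leftLim f t := by
  obtain ⟨l, hl⟩ := hf.left t ht
  rwa [leftLim_eq_of_eventually hl]

lemma tendsto_left (hf : IsStepPath f) {t : ℝ} (ht : 0 < t) :
    ∃ l, Tendsto f (𝓝[<] t) (𝓝 l) := by
  obtain ⟨l, hl⟩ := hf.left t ht
  exact ⟨l, tendsto_const_nhds.congr' (hl.mono fun u hu => hu.symm)⟩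

lemma finite_jumps (hf : IsStepPath f) (T : ℝ) :
    {s | s ∈ Set.Ioc 0 T ∧ jumpAt f s ≠ 0}.Finite := by
  have : (Set.Icc 0 T ∩ {s | 0 < s ∧ jumpAt f s ≠ 0}).Finite := by
    refine isCompact_Icc.finite_of_isolated fun t ht => ?_
    have hR := eventually_right_jumpAt_eq_zero (hf.right t ht.1)
    have hsplit : 𝓝[Set.Icc 0 T \ {t}] t ≤ 𝓝[Set.Icc 0 t \ {t}] t ⊔ 𝓝[>] t := by
      rw [← nhdsWithin_union]
      refine nhdsWithin_mono _ fun u hu => ?_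
      rcases lt_or_gt_of_ne hu.2 with h | h
      · exact Or.inl ⟨⟨hu.1.1, h.le⟩, hu.2⟩
      · exact Or.inr h
    refine Filter.Eventually.filter_mono hsplit (eventually_sup.2 ⟨?_, hR.mono fun u hu h => h.2 hu⟩)
    rcases ht.1.eq_or_lt with h0 | h0
    · subst h0
      simp
    · obtain ⟨l, hl⟩ := hf.left t h0
      have hL := eventually_left_jumpAt_eq_zero hl
      refine (hL.filter_mono (nhdsWithin_mono _ ?_)).mono fun u hu h => h.2 hu
      exact fun u hu => lt_of_le_of_ne hu.1.2 hu.2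
  refine this.subset ?_
  rintro s ⟨hs, hj⟩
  exact ⟨⟨hs.1.le, hs.2⟩, hs.1, hj⟩

/-- Just after `t` all jumps vanish; `k ≠ 0` is essential, since otherwise these zero jumps would
themselves be counted. -/
lemma jumpCount_right (hY : IsStepPath Y) {k : ℤ} (hk : k ≠ 0) {t : ℝ} (ht : 0 ≤ t) :
    ∀ᶠ u in 𝓝[>] t, jumpCount Y k u = jumpCount Y k t := by
  have h := eventually_right_jumpAt_eq_zero (hY.right t ht)
  obtain ⟨b, hb, hbs⟩ := mem_nhdsGT_iff_exists_Ioo_subset.1 h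
  filter_upwards [Ioo_mem_nhdsGT hb] with u hu
  unfold jumpCount
  congr 2
  ext s
  simp only [Set.mem_ofPred_eq, Set.mem_Ioc]
  constructor
  · rintro ⟨⟨h1, h2⟩, h3⟩
    refine ⟨⟨h1, ?_⟩, h3⟩
    by_contra hst
    have : jumpAt Y s = 0 := hbs ⟨not_le.1 hst, h2.trans_lt hu.2⟩
    rw [this] at h3
    exact hk (by exact_mod_cast h3.symm)
  · rintro ⟨⟨h1, h2⟩, h3⟩
    exact ⟨⟨h1, h2.trans hu.1.le⟩, h3⟩

lemma jumpCount_left (hY : IsStepPath Y) {k : ℤ} (hk : k ≠ 0) {t : ℝ} (ht : 0 < t) :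
    ∀ᶠ u in 𝓝[<] t,
      jumpCount Y k t = jumpCount Y k u + if jumpAt Y t = k then 1 else 0 := by
  obtain ⟨l, hl⟩ := hY.left t ht
  obtain ⟨b, hb, hbs⟩ := mem_nhdsLT_iff_exists_Ioo_subset.1 (eventually_left_jumpAt_eq_zero hl)
  filter_upwards [Ioo_mem_nhdsLT hb, Ioo_mem_nhdsLT ht] with u hu hu0
  have key : ∀ s, (s ∈ Set.Ioc 0 t ∧ jumpAt Y s = k) ↔
      (s ∈ Set.Ioc 0 u ∧ jumpAt Y s = k) ∨ (s = t ∧ jumpAt Y t = k) := by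
    intro s
    constructor
    · rintro ⟨⟨h1, h2⟩, h3⟩
      rcases h2.eq_or_lt with h | h
      · subst h; exact Or.inr ⟨rfl, h3⟩
      · refine Or.inl ⟨⟨h1, ?_⟩, h3⟩
        by_contra hsu
        have : jumpAt Y s = 0 := hbs ⟨hu.1.trans (not_le.1 hsu), h⟩
        rw [this] at h3
        exact hk (by exact_mod_cast h3.symm)
    · rintro (⟨⟨h1, h2⟩, h3⟩ | ⟨rfl, h⟩)
      · exact ⟨⟨h1, h2.trans hu.2.le⟩, h3⟩
      · exact ⟨⟨ht, le_rfl⟩, h⟩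
  -- Finiteness matters because `Set.ncard` of an infinite set is `0`, and then inserting `t` would
  -- not add one.
  have hfin : {s | s ∈ Set.Ioc 0 u ∧ jumpAt Y s = k}.Finite :=
    (hY.finite_jumps u).subset fun s hs =>
      ⟨hs.1, by rw [hs.2]; exact_mod_cast hk⟩
  unfold jumpCount
  split_ifs with hj
  · have : {s | s ∈ Set.Ioc 0 t ∧ jumpAt Y s = k} =
        insert t {s | s ∈ Set.Ioc 0 u ∧ jumpAt Y s = k} := by
      ext s
      rw [Set.mem_ofPred_eq, key s, Set.mem_insert_iff, Set.mem_ofPred_eq]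
      simp only [hj, and_true]
      tauto
    rw [this, Set.ncard_insert_of_notMem _ hfin]
    · push_cast; ring
    · exact fun h => absurd h.1.2 (not_le.2 hu.2)
  · have : {s | s ∈ Set.Ioc 0 t ∧ jumpAt Y s = k} = {s | s ∈ Set.Ioc 0 u ∧ jumpAt Y s = k} := by
      ext s
      rw [Set.mem_ofPred_eq, key s, Set.mem_ofPred_eq]
      simp only [hj, and_false, or_false]
    rw [this, add_zero]

end IsStepPath

lemma jumpCount_zero (Y : ℝ → ℝ) (k : ℤ) : jumpCount Y k 0 = 0 := by
  simp [jumpCount]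

/-- Local constancy on both sides gives continuity and zero right derivative. At time `0` only the
right side is needed. -/
lemma eq_of_locally_constant_nonneg {D : ℝ → ℝ}
    (hr : ∀ t, 0 ≤ t → ∀ᶠ u in 𝓝[>] t, D u = D t)
    (hl : ∀ t, 0 < t → ∀ᶠ u in 𝓝[<] t, D u = D t) {t : ℝ} (ht : 0 ≤ t) : D t = D 0 := by
  refine constant_of_has_deriv_right_zero (a := 0) (b := t) ?_ ?_ t ⟨ht, le_rfl⟩
  · intro s hs
    have hR : Tendsto D (𝓝[≥] s) (𝓝 (D s)) := by
      refine tendsto_const_nhds.congr' ?_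
      rw [← Set.Ioi_insert, nhdsWithin_insert]
      exact eventually_sup.2 ⟨by simp, (hr s hs.1).mono fun u hu => hu.symm⟩
    rcases hs.1.eq_or_lt with h0 | h0
    · subst h0
      exact hR.mono_left (nhdsWithin_mono _ fun u hu => hu.1)
    · have hL : Tendsto D (𝓝[<] s) (𝓝 (D s)) :=
        tendsto_const_nhds.congr' ((hl s h0).mono fun u hu => hu.symm)
      have : Tendsto D (𝓝 s) (𝓝 (D s)) := by
        rw [← nhdsLT_sup_nhdsGE]
        exact hL.sup hR
      exact this.mono_left nhdsWithin_le_nhds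
  · intro s hs
    refine (hasDerivWithinAt_const s (Set.Ici s) (D s)).congr_of_eventuallyEq ?_ rfl
    rw [← Set.Ioi_insert, nhdsWithin_insert]
    exact eventually_sup.2 ⟨by simp, hr s hs.1⟩

/-- If the jumps of `C` record the jumps of size `± k` of `Y`, the net number of downward jumps
of size `k` of `Y` is the decrease of `C`. -/
lemma jumpCount_sub_jumpCount {Y C : ℝ → ℝ} (hY : IsStepPath Y) (hC : IsStepPath C) {k : ℤ}
    (hk : 0 < k)
    (hjump : ∀ t, 0 < t → jumpAt C t =
      (if jumpAt Y t = k then 1 else 0) - (if jumpAt Y t = ((-k : ℤ) : ℝ) then 1 else 0))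
    {t : ℝ} (ht : 0 ≤ t) : jumpCount Y (-k) t - jumpCount Y k t = C 0 - C t := by
  have hk0 : k ≠ 0 := hk.ne'
  have hk1 : -k ≠ 0 := neg_ne_zero.2 hk0
  have := eq_of_locally_constant_nonneg
    (D := fun t => jumpCount Y (-k) t - jumpCount Y k t + C t) ?_ ?_ ht
  · simp only [jumpCount_zero] at this
    linarith
  · intro t ht
    filter_upwards [hY.jumpCount_right hk0 ht, hY.jumpCount_right hk1 ht, hC.right t ht]
      with u h1 h2 h3
    rw [h1, h2, h3]
  · intro t ht
    filter_upwards [hY.jumpCount_left hk0 ht, hY.jumpCount_left hk1 ht, hC.left_leftLim ht]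
      with u h1 h2 h3
    have h4 := hjump t ht
    rw [jumpAt] at h4
    rw [h1, h2, h3]
    linarith

lemma bddAbove_image_sub {C : ℝ → ℝ} (hnn : ∀ t, 0 ≤ t → 0 ≤ C t) (T : ℝ) :
    BddAbove ((fun t => C 0 - C t) '' Set.Icc 0 T) := by
  refine ⟨C 0, ?_⟩
  rintro _ ⟨t, ht, rfl⟩
  have := hnn t ht.1
  simp only
  linarith

/-! ### Deterministic bounds for a single path. -/

section PathBounds

variable {Y : ℝ → ℝ} {C : ℤ → ℝ → ℝ}
  (hcount : ∀ k : ℤ, 0 < k → ∀ t, 0 ≤ t →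
    jumpCount Y (-k) t - jumpCount Y k t = C k 0 - C k t)
  (hnn : ∀ k : ℤ, ∀ t, 0 ≤ t → 0 ≤ C k t)

include hcount

lemma image_jumpCount_sub {k : ℤ} (hk : 0 < k) (T : ℝ) :
    (fun t => jumpCount Y (-k) t - jumpCount Y k t) '' Set.Icc 0 T =
      (fun t => C k 0 - C k t) '' Set.Icc 0 T :=
  Set.image_congr fun t ht => hcount k hk t ht.1

include hnn

lemma lowerBound_le {k : ℤ} (hk : 0 < k) (T : ℝ) : lowerBound Y k T ≤ C k 0 := by
  rw [lowerBound, image_jumpCount_sub hcount hk]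
  -- For `T < 0` the set is empty and its supremum is `0` by convention, which is why `0 ≤ C k 0` is
  -- supplied.
  refine Real.sSup_le ?_ (hnn k 0 le_rfl)
  rintro _ ⟨t, ht, rfl⟩
  have := hnn k t ht.1
  simp only
  linarith

lemma le_lowerBound {k : ℤ} (hk : 0 < k) {t T : ℝ} (ht : 0 ≤ t) (htT : t ≤ T) :
    C k 0 - C k t ≤ lowerBound Y k T := by
  rw [lowerBound, image_jumpCount_sub hcount hk]
  exact le_csSup (bddAbove_image_sub (hnn k) T) ⟨t, ⟨ht, htT⟩, rfl⟩

lemma lowerBound_eq {k : ℤ} (hk : 0 < k) {t T : ℝ} (ht : 0 ≤ t) (htT : t ≤ T)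
    (hzero : C k t = 0) : lowerBound Y k T = C k 0 := by
  refine le_antisymm (lowerBound_le hcount hnn hk T) ?_
  have := le_lowerBound hcount hnn hk ht htT
  rwa [hzero, sub_zero] at this

lemma lowerBound_eq_zero {k : ℤ} (hk : 0 < k) {T : ℝ} (hT : 0 ≤ T) (h : C k 0 = 0) :
    lowerBound Y k T = 0 := by
  refine le_antisymm (h ▸ lowerBound_le hcount hnn hk T) ?_
  have := le_lowerBound hcount hnn hk le_rfl hT
  rwa [sub_self] at this

variable {K : Finset ℤ} (hK : ∀ k : ℤ, 0 < k → k ∉ K → C k 0 = 0) (hKpos : ∀ k ∈ K, 0 < k)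

-- A size absent at time `0` has lower bound exactly `0`: the supremum is at most `C k 0 = 0` and at
-- least its value at `t = 0`. The series therefore has finite support.
include hK hKpos in
lemma hasSum_lowerBound {y : ℤ} {T : ℝ} (hT : 0 ≤ T) :
    HasSum (fun k : {k : ℤ // 0 < k ∧ k ≠ y} => (k.1 : ℝ) * lowerBound Y k.1 T)
      (∑ k ∈ K.erase y, (k : ℝ) * lowerBound Y k T) := by
  have h : HasSum (Set.indicator {k : ℤ | 0 < k ∧ k ≠ y} (fun k => (k : ℝ) * lowerBound Y k T))
      (∑ k ∈ K.erase y,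
        Set.indicator {k : ℤ | 0 < k ∧ k ≠ y} (fun k => (k : ℝ) * lowerBound Y k T) k) := by
    refine hasSum_sum_of_ne_finset_zero fun k hk => ?_
    by_cases hk1 : 0 < k ∧ k ≠ y
    · have hkK : k ∉ K := fun h => hk (Finset.mem_erase.2 ⟨hk1.2, h⟩)
      rw [Set.indicator_of_mem (s := {k : ℤ | 0 < k ∧ k ≠ y}) hk1,
        lowerBound_eq_zero hcount hnn hk1.1 hT (hK k hk1.1 hkK), mul_zero]
    · exact Set.indicator_of_notMem (s := {k : ℤ | 0 < k ∧ k ≠ y}) hk1 _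
  have hs := hasSum_subtype_iff_indicator.2 h
  have hsum : ∑ k ∈ K.erase y,
        Set.indicator {k : ℤ | 0 < k ∧ k ≠ y} (fun k => (k : ℝ) * lowerBound Y k T) k =
      ∑ k ∈ K.erase y, (k : ℝ) * lowerBound Y k T := by
    refine Finset.sum_congr rfl fun k hk => ?_
    rw [Finset.mem_erase] at hk
    exact Set.indicator_of_mem (s := {k : ℤ | 0 < k ∧ k ≠ y}) ⟨hKpos k hk.2, hk.1⟩ _
  rw [hsum] at hs
  exact hs

variable (hsum : Y 0 = ∑ k ∈ K, (k : ℝ) * C k 0)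

include hK hsum in
omit hcount hnn in
lemma sub_sum_erase {y : ℤ} (hy : 0 < y) :
    Y 0 - ∑ k ∈ K.erase y, (k : ℝ) * C k 0 = y * C y 0 := by
  by_cases hyK : y ∈ K
  · rw [hsum, ← Finset.add_sum_erase K _ hyK]
    ring
  · rw [Finset.erase_eq_of_notMem hyK, hsum, sub_self, hK y hy hyK, mul_zero]

-- Integrality of the count (`hm`) lets the floor be removed; the rest compares the two sums over
-- the other sizes term by term.
include hK hKpos hsum in
lemma le_upperBound {y : ℤ} (hy : 0 < y) {m : ℤ} (hm : C y 0 = m) {T : ℝ} (hT : 0 ≤ T) :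
    C y 0 ≤ (upperBound Y y T : ℝ) := by
  rw [hm, Int.cast_le, upperBound, Int.le_floor, (hasSum_lowerBound hcount hnn hK hKpos hT).tsum_eq,
    le_div_iff₀ (by exact_mod_cast hy), ← hm, mul_comm, ← sub_sum_erase hK hsum hy]
  refine sub_le_sub_left (Finset.sum_le_sum fun k hk => ?_) _
  have hk0 := hKpos k (Finset.mem_of_mem_erase hk)
  exact mul_le_mul_of_nonneg_left (lowerBound_le hcount hnn hk0 T) (by exact_mod_cast hk0.le)

variable (hzero : ∀ k : ℤ, 0 < k → ∃ t, 0 ≤ t ∧ C k t = 0)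

include hzero

lemma eventually_lowerBound_eq {k : ℤ} (hk : 0 < k) : ∀ᶠ T in atTop, lowerBound Y k T = C k 0 := by
  obtain ⟨t, ht, h0⟩ := hzero k hk
  filter_upwards [eventually_ge_atTop t] with T hT
  exact lowerBound_eq hcount hnn hk ht hT h0

include hK hKpos hsum in
lemma eventually_upperBound_eq {y : ℤ} (hy : 0 < y) {m : ℤ} (hm : C y 0 = m) :
    ∀ᶠ T in atTop, (upperBound Y y T : ℝ) = C y 0 := by
  have h : ∀ᶠ T in atTop, ∀ k ∈ K, lowerBound Y k T = C k 0 :=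
    (Filter.eventually_all_finset K).2
      fun k hk => eventually_lowerBound_eq hcount hnn hzero (hKpos k hk)
  filter_upwards [h, eventually_ge_atTop 0] with T hTK hT
  have hy0 : (y : ℝ) ≠ 0 := by exact_mod_cast hy.ne'
  rw [upperBound, (hasSum_lowerBound hcount hnn hK hKpos hT).tsum_eq,
    Finset.sum_congr rfl (g := fun k : ℤ => (k : ℝ) * C k 0)
      (fun k hk => by rw [hTK k (Finset.mem_of_mem_erase hk)]),
    sub_sum_erase hK hsum hy, mul_div_cancel_left₀ _ hy0, hm, Int.floor_intCast]

end PathBounds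

/-! ### Poisson estimates and moments of Poisson counts. -/

lemma lintegral_poissonMeasure_id (r : NNReal) :
    ∫⁻ k : ℕ, (k : ℝ≥0∞) ∂(poissonMeasure r) = r := by
  rw [lintegral_countable', tsum_eq_zero_add' ENNReal.summable]
  -- The recursion `(k+1) p_{k+1} = r p_k` reduces the mean to `r` times the total mass.
  have h : ∀ k : ℕ, ((k + 1 : ℕ) : ℝ≥0∞) * poissonMeasure r {k + 1} =
      r * poissonMeasure r {k} := by
    intro k
    rw [poissonMeasure_singleton, poissonMeasure_singleton, ← ENNReal.ofReal_natCast,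
      ← ENNReal.ofReal_coe_nnreal, ← ENNReal.ofReal_mul (by positivity),
      ← ENNReal.ofReal_mul (by positivity)]
    congr 1
    rw [Nat.factorial_succ]
    push_cast
    field_simp
    ring
  simp_rw [h]
  rw [ENNReal.tsum_mul_left]
  have h1 : ∑' k : ℕ, poissonMeasure r {k} = 1 := by
    have := lintegral_countable' (μ := poissonMeasure r) (fun _ => 1)
    simpa using this.symm
  simp [h1]

/-- Because `e^{-r} ≥ 1 - r`, one has `1 - e^{-r}(1 + r) ≤ 1 - (1 - r)(1 + r) = r^2`. -/
lemma poissonMeasure_two_le (r : NNReal) :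
    poissonMeasure r {k | 2 ≤ k} ≤ (r : ℝ≥0∞) ^ 2 := by
  have hc : {k : ℕ | 2 ≤ k} = ({0, 1} : Set ℕ)ᶜ := by
    ext k
    simp only [Set.mem_ofPred_eq, Set.mem_compl_iff, Set.mem_insert_iff, Set.mem_singleton_iff]
    lia
  have hu : ({0, 1} : Set ℕ) = {0} ∪ {1} := rfl
  have h : (poissonMeasure r).real {k | 2 ≤ k} ≤ (r : ℝ) ^ 2 := by
    rw [hc, probReal_compl_eq_one_sub (by measurability), hu,
      measureReal_union (by simp) (by measurability), poissonMeasure_real_singleton,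
      poissonMeasure_real_singleton]
    have h1 := Real.one_sub_le_exp_neg (r : ℝ)
    have h2 : (0 : ℝ) ≤ r := r.2
    simp only [pow_zero, Nat.factorial, pow_one, Nat.cast_one, mul_one, div_one]
    nlinarith
  rw [← ofReal_measureReal, ← ENNReal.ofReal_coe_nnreal, ← ENNReal.ofReal_pow r.coe_nonneg]
  exact ENNReal.ofReal_le_ofReal h

namespace IsPoissonRandomMeasure

variable {Ω E : Type*} [MeasurableSpace Ω] [MeasurableSpace E] {P : Measure Ω}
  {N : Ω → Measure E} {Λ : Measure E}

lemma lintegral_apply (hN : IsPoissonRandomMeasure N Λ P) {B : Set E} (hB : MeasurableSet B)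
    (hfin : Λ B ≠ ⊤) : ∫⁻ ω, N ω B ∂P = Λ B := by
  have h := lintegral_map (μ := P) (f := fun x : ℝ≥0∞ => x) measurable_id (hN.measurable_apply B hB)
  rw [← h, hN.poisson B hB hfin, lintegral_map (f := fun x : ℝ≥0∞ => x) measurable_id (by fun_prop),
    lintegral_poissonMeasure_id, ENNReal.coe_toNNReal hfin]

lemma ae_lt_top (hN : IsPoissonRandomMeasure N Λ P) {B : Set E} (hB : MeasurableSet B)
    (hfin : Λ B ≠ ⊤) : ∀ᵐ ω ∂P, N ω B < ⊤ :=
  MeasureTheory.ae_lt_top (hN.measurable_apply B hB) (by rwa [hN.lintegral_apply hB hfin])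

lemma ae_eq_zero (hN : IsPoissonRandomMeasure N Λ P) {B : Set E} (hB : MeasurableSet B)
    (h0 : Λ B = 0) : ∀ᵐ ω ∂P, N ω B = 0 := by
  have h := hN.lintegral_apply hB (by simp [h0])
  rw [h0, lintegral_eq_zero_iff (hN.measurable_apply B hB)] at h
  exact h

lemma measure_preimage (hN : IsPoissonRandomMeasure N Λ P) {B : Set E} (hB : MeasurableSet B)
    (hfin : Λ B ≠ ⊤) {S : Set ℝ≥0∞} (hS : MeasurableSet S) :
    P {ω | N ω B ∈ S} = poissonMeasure (Λ B).toNNReal {k : ℕ | (k : ℝ≥0∞) ∈ S} := by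
  have h := congrArg (fun m => m S) (hN.poisson B hB hfin)
  rwa [Measure.map_apply (hN.measurable_apply B hB) hS, Measure.map_apply (by fun_prop) hS] at h

lemma measure_eq_natCast (hN : IsPoissonRandomMeasure N Λ P) {B : Set E} (hB : MeasurableSet B)
    (hfin : Λ B ≠ ⊤) (n : ℕ) :
    P {ω | N ω B = n} = poissonMeasure (Λ B).toNNReal {n} := by
  have h := hN.measure_preimage hB hfin (measurableSet_singleton (n : ℝ≥0∞))
  simpa using h

lemma measure_two_le (hN : IsPoissonRandomMeasure N Λ P) {B : Set E} (hB : MeasurableSet B)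
    (hfin : Λ B ≠ ⊤) : P {ω | 2 ≤ N ω B} ≤ Λ B ^ 2 := by
  have h := hN.measure_preimage hB hfin (measurableSet_Ici (a := (2 : ℝ≥0∞)))
  have h2 : {k : ℕ | (k : ℝ≥0∞) ∈ Set.Ici 2} = {k | 2 ≤ k} := by
    ext k
    simp only [Set.mem_Ici, Set.mem_ofPred_eq]
    exact_mod_cast Iff.rfl
  simp only [Set.mem_Ici] at h h2
  rw [h, h2]
  refine (poissonMeasure_two_le _).trans ?_
  rw [ENNReal.coe_toNNReal hfin]

/-- Markov's inequality: a nonzero integer-valued count is at least `1`. -/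
lemma measure_ne_zero_le (hN : IsPoissonRandomMeasure N Λ P) {B : Set E} (hB : MeasurableSet B)
    (hfin : Λ B ≠ ⊤) : P {ω | N ω B ≠ 0} ≤ Λ B := by
  have h := mul_meas_ge_le_lintegral (μ := P) (hN.measurable_apply B hB) 1
  rw [one_mul, hN.lintegral_apply hB hfin] at h
  refine (measure_mono fun ω hω => ?_).trans h
  obtain ⟨k, hk⟩ := hN.integer_valued ω B hB
  have hω' : N ω B ≠ 0 := hω
  rw [hk] at hω'
  have : 1 ≤ k := Order.one_le_iff_ne_zero.2 (by rintro rfl; simp at hω')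
  change 1 ≤ N ω B
  rw [hk]
  exact_mod_cast this

lemma indepFun_pair [IsProbabilityMeasure P] (hN : IsPoissonRandomMeasure N Λ P) {B₁ B₂ : Set E}
    (h₁ : MeasurableSet B₁) (h₂ : MeasurableSet B₂) (hd : Disjoint B₁ B₂) :
    IndepFun (fun ω => N ω B₁) (fun ω => N ω B₂) P := by
  have h := hN.indep 2 ![B₁, B₂] (by intro i; fin_cases i <;> simpa) ?_
  · exact h.indepFun (i := 0) (j := 1) (by simp)
  · intro i j hij
    fin_cases i <;> fin_cases j <;> simp_all [disjoint_comm]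

lemma lintegral_mul [IsProbabilityMeasure P] (hN : IsPoissonRandomMeasure N Λ P) {B₁ B₂ : Set E}
    (h₁ : MeasurableSet B₁) (h₂ : MeasurableSet B₂) (hd : Disjoint B₁ B₂)
    (hf₁ : Λ B₁ ≠ ⊤) (hf₂ : Λ B₂ ≠ ⊤) :
    ∫⁻ ω, N ω B₁ * N ω B₂ ∂P = Λ B₁ * Λ B₂ := by
  rw [← hN.lintegral_apply h₁ hf₁, ← hN.lintegral_apply h₂ hf₂]
  exact lintegral_mul_eq_lintegral_mul_lintegral_of_indepFun (hN.measurable_apply _ h₁)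
    (hN.measurable_apply _ h₂) (hN.indepFun_pair h₁ h₂ hd)

end IsPoissonRandomMeasure

/-! ### Pairs of points and the product intensity. -/

namespace IsPoissonRandomMeasure

variable {Ω E : Type*} [MeasurableSpace Ω] [MeasurableSpace E] {P : Measure Ω}
  {N : Ω → Measure E} {Λ : Measure E}

open Classical in
/-- A null set of the product intensity contains almost surely no pair of points of a Poisson
random measure that lie in given disjoint sets of finite intensity. -/
lemma ae_not_mem_of_prod_null [IsProbabilityMeasure P] [MeasurableSingletonClass E]
    (hN : IsPoissonRandomMeasure N Λ P) {U V : Set E} (hU : MeasurableSet U)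
    (hV : MeasurableSet V) (hUV : Disjoint U V) (hfU : Λ U ≠ ⊤) (hfV : Λ V ≠ ⊤) {C : Set (E × E)}
    (hC : MeasurableSet C) (h0 : ((Λ.restrict U).prod (Λ.restrict V)) C = 0) :
    ∀ᵐ ω ∂P, ∀ p ∈ U, ∀ q ∈ V, (p, q) ∈ C → N ω {p} = 0 ∨ N ω {q} = 0 := by
  let good : Set Ω := {ω | N ω U < ⊤ ∧ N ω V < ⊤}
  have hgood : MeasurableSet good :=
    (measurableSet_lt (hN.measurable_apply U hU) measurable_const).inter
      (measurableSet_lt (hN.measurable_apply V hV) measurable_const)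
  -- Setting `M` to zero off the almost sure event `good` makes it a finite measure for every `ω`,
  -- as needed to check its measurability on rectangles only.
  let M : Ω → Measure (E × E) := fun ω =>
    if ω ∈ good then ((N ω).restrict U).prod ((N ω).restrict V) else 0
  have hMgood : ∀ ω ∈ good, M ω = ((N ω).restrict U).prod ((N ω).restrict V) :=
    fun ω hω => if_pos hω
  have hMbad : ∀ ω ∉ good, M ω = 0 := fun ω hω => if_neg hω
  have hfin : ∀ ω ∈ good, IsFiniteMeasure ((N ω).restrict U) ∧
      IsFiniteMeasure ((N ω).restrict V) := fun ω hω =>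
    ⟨⟨by rw [Measure.restrict_apply_univ]; exact hω.1⟩,
      ⟨by rw [Measure.restrict_apply_univ]; exact hω.2⟩⟩
  have hMfin : ∀ ω, IsFiniteMeasure (M ω) := by
    intro ω
    by_cases hω : ω ∈ good
    · obtain ⟨h1, h2⟩ := hfin ω hω
      rw [hMgood ω hω]
      infer_instance
    · rw [hMbad ω hω]
      infer_instance
  have hMrect : ∀ B₁ B₂ : Set E, MeasurableSet B₁ → MeasurableSet B₂ →
      (fun ω => M ω (B₁ ×ˢ B₂)) =
        good.indicator (fun ω => N ω (B₁ ∩ U) * N ω (B₂ ∩ V)) := by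
    intro B₁ B₂ h₁ h₂
    ext ω
    by_cases hω : ω ∈ good
    · obtain ⟨h1, h2⟩ := hfin ω hω
      rw [hMgood ω hω, Set.indicator_of_mem hω, Measure.prod_prod, Measure.restrict_apply h₁,
        Measure.restrict_apply h₂]
    · rw [hMbad ω hω, Set.indicator_of_notMem hω, Measure.coe_zero, Pi.zero_apply]
  have hMmeas : Measurable M := by
    refine Measurable.measure_of_isPiSystem generateFrom_prod.symm isPiSystem_prod ?_ ?_
    · rintro _ ⟨B₁, h₁, B₂, h₂, rfl⟩
      rw [hMrect B₁ B₂ h₁ h₂]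
      exact ((hN.measurable_apply _ (MeasurableSet.inter h₁ hU)).mul
        (hN.measurable_apply _ (MeasurableSet.inter h₂ hV))).indicator hgood
    · rw [← Set.univ_prod_univ, hMrect _ _ .univ .univ]
      exact ((hN.measurable_apply _ (MeasurableSet.inter .univ hU)).mul
        (hN.measurable_apply _ (MeasurableSet.inter .univ hV))).indicator hgood
  have hae : ∀ᵐ ω ∂P, ω ∈ good := by
    filter_upwards [hN.ae_lt_top hU hfU, hN.ae_lt_top hV hfV] with ω h1 h2
    exact ⟨h1, h2⟩
  have : IsFiniteMeasure (Λ.restrict U) :=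
    ⟨by rw [Measure.restrict_apply_univ]; exact hfU.lt_top⟩
  have : IsFiniteMeasure (Λ.restrict V) :=
    ⟨by rw [Measure.restrict_apply_univ]; exact hfV.lt_top⟩
  -- The mean of the random product measure is the product intensity: on rectangles this is
  -- independence of counts on disjoint sets, and rectangles determine the product measure.
  have hprod : (Λ.restrict U).prod (Λ.restrict V) = P.bind M := by
    refine Measure.prod_eq fun B₁ B₂ h₁ h₂ => ?_
    rw [Measure.bind_apply (h₁.prod h₂) hMmeas.aemeasurable, hMrect _ _ h₁ h₂,
      Measure.restrict_apply h₁, Measure.restrict_apply h₂,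
      ← hN.lintegral_mul (h₁.inter hU) (h₂.inter hV)
        (hUV.mono Set.inter_subset_right Set.inter_subset_right)
        (ne_top_of_le_ne_top hfU (measure_mono Set.inter_subset_right))
        (ne_top_of_le_ne_top hfV (measure_mono Set.inter_subset_right))]
    refine lintegral_congr_ae ?_
    filter_upwards [hae] with ω hω
    rw [Set.indicator_of_mem hω]
  have hMC : Measurable fun ω => M ω C := (Measure.measurable_coe hC).comp hMmeas
  rw [hprod, Measure.bind_apply hC hMmeas.aemeasurable, lintegral_eq_zero_iff hMC] at h0
  filter_upwards [h0, hae] with ω h0 hω p hp q hq hpq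
  obtain ⟨h1, h2⟩ := hfin ω hω
  have h3 : M ω ({p} ×ˢ {q}) = 0 := by
    refine measure_mono_null ?_ h0
    rintro ⟨a, b⟩ ⟨rfl, rfl⟩
    exact hpq
  rw [hMgood ω hω, Measure.prod_prod, Measure.restrict_apply (measurableSet_singleton p),
    Measure.restrict_apply (measurableSet_singleton q),
    Set.inter_eq_left.2 (Set.singleton_subset_iff.2 hp),
    Set.inter_eq_left.2 (Set.singleton_subset_iff.2 hq)] at h3
  exact mul_eq_zero.1 h3

end IsPoissonRandomMeasure

/-! ### Atoms of integer-valued measures. -/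

/-- A measure that takes values in `ℕ ∪ {∞}` is, on a set of finite measure, carried by finitely
many points. -/
lemma exists_finset_carrier {E : Type*} [MeasurableSpace E] [EMetricSpace E]
    [SecondCountableTopology E] [BorelSpace E] {μ : Measure E}
    (hint : ∀ B, MeasurableSet B → ∃ k : ℕ∞, μ B = (k : ℝ≥0∞)) {S : Set E} (hS : MeasurableSet S)
    (hfin : μ S ≠ ⊤) :
    ∃ F : Finset E, (∀ p ∈ F, p ∈ S ∧ μ {p} ≠ 0) ∧ μ (S \ F) = 0 := by
  have one_le : ∀ B, MeasurableSet B → μ B ≠ 0 → 1 ≤ μ B := by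
    intro B hB h
    obtain ⟨k, hk⟩ := hint B hB
    rw [hk] at h ⊢
    have : 1 ≤ k := Order.one_le_iff_ne_zero.2 (by rintro rfl; simp at h)
    exact_mod_cast this
  have hfinite : {p | p ∈ S ∧ μ {p} ≠ 0}.Finite := by
    by_contra hinf
    obtain ⟨n, hn⟩ := ENNReal.exists_nat_gt hfin
    obtain ⟨t, ht, htc⟩ := Set.Infinite.exists_subset_card_eq hinf n
    have h1 : (n : ℝ≥0∞) ≤ μ t := by
      rw [← sum_measure_singleton, ← htc, ← nsmul_one t.card]
      exact Finset.card_nsmul_le_sum _ _ _ fun p hp => one_le _ (measurableSet_singleton p) (ht hp).2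
    exact absurd (h1.trans (measure_mono fun p hp => (ht hp).1)) (not_le.2 hn)
  refine ⟨hfinite.toFinset, fun p hp => by simpa using hp, ?_⟩
  -- By second countability a locally null set is null. Around a point that is not an atom, the
  -- masses of shrinking balls tend to `0`, and integer values force them to vanish eventually.
  refine measure_null_of_locally_null _ fun p hp => ?_
  have hp0 : μ {p} = 0 := by
    by_contra h
    exact hp.2 (by simpa using ⟨hp.1, h⟩)
  have hlim : Tendsto (fun n : ℕ => μ (S ∩ Metric.eball p (n : ℝ≥0∞)⁻¹)) atTop
      (𝓝 (μ (⋂ n : ℕ, S ∩ Metric.eball p (n : ℝ≥0∞)⁻¹))) := by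
    refine tendsto_measure_iInter_atTop
      (fun n => (hS.inter Metric.isOpen_eball.measurableSet).nullMeasurableSet) ?_
      ⟨0, ne_top_of_le_ne_top hfin (measure_mono Set.inter_subset_left)⟩
    intro m n hmn
    refine Set.inter_subset_inter_right _ (Metric.eball_subset_eball ?_)
    exact ENNReal.inv_le_inv.2 (by exact_mod_cast hmn)
  have hInter : μ (⋂ n : ℕ, S ∩ Metric.eball p (n : ℝ≥0∞)⁻¹) = 0 := by
    refine measure_mono_null ?_ hp0
    intro q hq
    rw [Set.mem_iInter] at hq
    have h0 : edist q p = 0 := by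
      by_contra h
      obtain ⟨n, hn⟩ := ENNReal.exists_inv_nat_lt h
      exact absurd (hq n).2 (not_lt.2 hn.le)
    exact (edist_eq_zero.1 h0)
  rw [hInter] at hlim
  obtain ⟨n, hn⟩ := (hlim.eventually (gt_mem_nhds one_pos)).exists
  have hz : μ (S ∩ Metric.eball p (n : ℝ≥0∞)⁻¹) = 0 := by
    by_contra h
    exact absurd (one_le _ (hS.inter Metric.isOpen_eball.measurableSet) h) (not_le.2 hn)
  refine ⟨S ∩ Metric.eball p (n : ℝ≥0∞)⁻¹, ?_, hz⟩
  refine mem_nhdsWithin.2 ⟨Metric.eball p (n : ℝ≥0∞)⁻¹, Metric.isOpen_eball, ?_, ?_⟩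
  · simp
  · exact fun q hq => ⟨hq.2.1, hq.1⟩

/-! ### Switch times of a single event. -/

/-- The section of `A` at height `x` is left-continuous with right limits. -/
def IsRegularHeight (A : Set (ℝ × ℝ)) (x : ℝ) : Prop :=
  ∀ s : ℝ, (∀ᶠ u in 𝓝[<] s, ((x, u) ∈ A ↔ (x, s) ∈ A)) ∧
    ((∀ᶠ u in 𝓝[>] s, (x, u) ∈ A) ∨ (∀ᶠ u in 𝓝[>] s, (x, u) ∉ A))

/-- The path of the indicator of the event that the point `z` lies in the trawl. -/
noncomputable def presence (A : Set (ℝ × ℝ)) (z : ℝ × ℝ) (t : ℝ) : ℝ :=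
  (trawlAt A t).indicator (fun _ => 1) z

/-- The times at which the point `z` enters or leaves the trawl. -/
def switchTimes (A : Set (ℝ × ℝ)) (z : ℝ × ℝ) : Set ℝ :=
  {t | ¬ ∀ᶠ u in 𝓝 t, (z ∈ trawlAt A u ↔ z ∈ trawlAt A t)}

lemma mem_trawlAt {A : Set (ℝ × ℝ)} {z : ℝ × ℝ} {t : ℝ} :
    z ∈ trawlAt A t ↔ (z.1, z.2 - t) ∈ A := Iff.rfl

lemma presence_congr {A : Set (ℝ × ℝ)} {z : ℝ × ℝ} {t u : ℝ}
    (h : z ∈ trawlAt A u ↔ z ∈ trawlAt A t) : presence A z u = presence A z t := by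
  unfold presence
  by_cases ht : z ∈ trawlAt A t
  · rw [Set.indicator_of_mem ht, Set.indicator_of_mem (h.2 ht)]
  · rw [Set.indicator_of_notMem ht, Set.indicator_of_notMem (fun hu => ht (h.1 hu))]

lemma measurableSet_trawlAt {A : Set (ℝ × ℝ)} (hA : MeasurableSet A) (t : ℝ) :
    MeasurableSet (trawlAt A t) :=
  (measurable_fst.prodMk (measurable_snd.sub_const t)) hA

section Regular

variable {A : Set (ℝ × ℝ)} {z : ℝ × ℝ} (hz : IsRegularHeight A z.1)

include hz

/-- The map `u ↦ z.2 - u` reverses time, turning left-continuity of the section into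
right-continuity of the presence path. -/
lemma IsRegularHeight.eventually_right (t : ℝ) :
    ∀ᶠ u in 𝓝[>] t, (z ∈ trawlAt A u ↔ z ∈ trawlAt A t) := by
  have h : Tendsto (fun u => z.2 - u) (𝓝[>] t) (𝓝[<] (z.2 - t)) := by
    refine tendsto_nhdsWithin_iff.2 ⟨?_, ?_⟩
    · exact (continuous_const.sub continuous_id).continuousAt.mono_left nhdsWithin_le_nhds
    · filter_upwards [self_mem_nhdsWithin] with u hu
      simpa using hu
  exact h.eventually (hz (z.2 - t)).1

lemma IsRegularHeight.eventually_left (t : ℝ) :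
    (∀ᶠ u in 𝓝[<] t, z ∈ trawlAt A u) ∨ (∀ᶠ u in 𝓝[<] t, z ∉ trawlAt A u) := by
  have h : Tendsto (fun u => z.2 - u) (𝓝[<] t) (𝓝[>] (z.2 - t)) := by
    refine tendsto_nhdsWithin_iff.2 ⟨?_, ?_⟩
    · exact (continuous_const.sub continuous_id).continuousAt.mono_left nhdsWithin_le_nhds
    · filter_upwards [self_mem_nhdsWithin] with u hu
      simpa using hu
  exact (hz (z.2 - t)).2.imp (fun h2 => h.eventually h2) (fun h2 => h.eventually h2)

lemma IsRegularHeight.presence_left (t : ℝ) :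
    (∀ᶠ u in 𝓝[<] t, presence A z u = 1) ∨ (∀ᶠ u in 𝓝[<] t, presence A z u = 0) :=
  (hz.eventually_left t).imp (fun h => h.mono fun _ hu => Set.indicator_of_mem hu _)
    (fun h => h.mono fun _ hu => Set.indicator_of_notMem hu _)

lemma IsRegularHeight.isStepPath : IsStepPath (presence A z) where
  right t _ := (hz.eventually_right t).mono fun _ hu => presence_congr hu
  left t _ := (hz.presence_left t).elim (fun h => ⟨1, h⟩) (fun h => ⟨0, h⟩)

lemma IsRegularHeight.jumpAt_presence (t : ℝ) : jumpAt (presence A z) t = 0 ∨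
    jumpAt (presence A z) t = 1 ∨ jumpAt (presence A z) t = -1 := by
  have h1 : presence A z t = 0 ∨ presence A z t = 1 := by
    unfold presence
    by_cases ht : z ∈ trawlAt A t
    · exact Or.inr (Set.indicator_of_mem ht _)
    · exact Or.inl (Set.indicator_of_notMem ht _)
  unfold jumpAt
  rcases hz.presence_left t with h | h <;> rw [leftLim_eq_of_eventually h] <;>
    rcases h1 with h1 | h1 <;> rw [h1] <;> norm_num

/-- One-sided limits make switch times isolated, so every compact interval contains finitely many.
-/
lemma IsRegularHeight.countable_switchTimes : (switchTimes A z).Countable := by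
  have h : ∀ n : ℕ, (Set.Icc (-n : ℝ) n ∩ switchTimes A z).Finite := by
    intro n
    refine isCompact_Icc.finite_of_isolated fun t _ => ?_
    refine Filter.Eventually.filter_mono (nhdsWithin_mono t fun u hu => hu.2) ?_
    change ∀ᶠ u in 𝓝[{t}ᶜ] t, u ∉ switchTimes A z
    rw [← Set.Iio_union_Ioi, nhdsWithin_union, eventually_sup]
    constructor
    · have h3 : ∃ c : Prop, ∀ᶠ u in 𝓝[<] t, (z ∈ trawlAt A u ↔ c) := by
        rcases hz.eventually_left t with h | h
        · exact ⟨True, h.mono fun u hu => by simpa using hu⟩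
        · exact ⟨False, h.mono fun u hu => by simpa using hu⟩
      obtain ⟨c, hc⟩ := h3
      filter_upwards [eventually_eventually_nhdsWithin.2 hc, hc, self_mem_nhdsWithin]
        with u hu huc hut
      rw [IsOpen.nhdsWithin_eq isOpen_Iio hut] at hu
      exact not_not_intro (hu.mono fun v hv => hv.trans huc.symm)
    · have hc := hz.eventually_right t
      filter_upwards [eventually_eventually_nhdsWithin.2 hc, hc, self_mem_nhdsWithin]
        with u hu huc hut
      rw [IsOpen.nhdsWithin_eq isOpen_Ioi hut] at hu
      exact not_not_intro (hu.mono fun v hv => hv.trans huc.symm)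
  refine (Set.countable_iUnion fun n => (h n).countable).mono fun t ht => ?_
  obtain ⟨n, hn⟩ := exists_nat_ge |t|
  exact Set.mem_iUnion.2 ⟨n, abs_le.1 hn, ht⟩

/-- Since presence is constant just before and just after `t`, a switch can be detected from any
pair of nearby times around it, in particular from rational ones. -/
lemma IsRegularHeight.exists_separated_of_mem_switchTimes {t : ℝ} (ht : t ∈ switchTimes A z) :
    (∃ a₀ < t, ∃ b₀ > t, ∀ a ∈ Set.Ioo a₀ t, ∀ b ∈ Set.Ioo t b₀,
      ¬ (z ∈ trawlAt A a ↔ z ∈ trawlAt A b)) := by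
  obtain ⟨b₀, hb₀, hb⟩ := mem_nhdsGT_iff_exists_Ioo_subset.1 (hz.eventually_right t)
  have key : ∃ a₀ < t, ∀ a ∈ Set.Ioo a₀ t, ¬ (z ∈ trawlAt A a ↔ z ∈ trawlAt A t) := by
    have hne : ∀ h : ∀ᶠ u in 𝓝[<] t, (z ∈ trawlAt A u ↔ z ∈ trawlAt A t), False := by
      intro h
      refine ht ?_
      rw [← nhdsLT_sup_nhdsGE, ← Set.Ioi_insert, nhdsWithin_insert]
      exact eventually_sup.2 ⟨h, eventually_sup.2 ⟨by simp, hz.eventually_right t⟩⟩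
    have h2 : ∀ᶠ u in 𝓝[<] t, ¬ (z ∈ trawlAt A u ↔ z ∈ trawlAt A t) := by
      by_cases hzt : z ∈ trawlAt A t
      · rcases hz.eventually_left t with h | h
        · exact (hne (h.mono fun u hu => iff_of_true hu hzt)).elim
        · exact h.mono fun u hu h => hu (h.2 hzt)
      · rcases hz.eventually_left t with h | h
        · exact h.mono fun u hu h => hzt (h.1 hu)
        · exact (hne (h.mono fun u hu => iff_of_false hu hzt)).elim
    obtain ⟨a₀, ha₀, ha⟩ := mem_nhdsLT_iff_exists_Ioo_subset.1 h2
    exact ⟨a₀, ha₀, fun a h => ha h⟩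
  obtain ⟨a₀, ha₀, ha⟩ := key
  exact ⟨a₀, ha₀, b₀, hb₀, fun a h b h' hab => ha a h (hab.trans (hb h'))⟩

end Regular

lemma jumpAt_presence_eq_zero {A : Set (ℝ × ℝ)} {z : ℝ × ℝ} {t : ℝ} (ht : t ∉ switchTimes A z) :
    jumpAt (presence A z) t = 0 :=
  jumpAt_eq_zero_of_eventually ((not_not.1 ht).mono fun _ hu => presence_congr hu)

/-! ### Common switch times of two events. -/

/-- Pairs of events at heights in `G` that are discovered to switch at a common time in `[0, M]`
by arbitrarily fine rational intervals. -/
def commonSwitchSet (A : Set (ℝ × ℝ)) (G : Set ℝ) (M : ℕ) :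
    Set ((ℤ × ℝ × ℝ) × (ℤ × ℝ × ℝ)) :=
  {w | (w.1.2.1 ∈ G ∧ w.2.2.1 ∈ G) ∧ ∀ n : ℕ, ∃ a b : ℚ,
    (0 ≤ (a : ℝ) ∧ (a : ℝ) < b ∧ (b : ℝ) ≤ M ∧ (b : ℝ) - a < 1 / (n + 1 : ℝ)) ∧
    ¬ (w.1.2 ∈ trawlAt A a ↔ w.1.2 ∈ trawlAt A b) ∧
    ¬ (w.2.2 ∈ trawlAt A a ↔ w.2.2 ∈ trawlAt A b)}

lemma measurableSet_commonSwitchSet {A : Set (ℝ × ℝ)} (hA : MeasurableSet A) {G : Set ℝ}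
    (hG : MeasurableSet G) (M : ℕ) : MeasurableSet (commonSwitchSet A G M) := by
  have h1 : ∀ t : ℝ, MeasurableSet {w : (ℤ × ℝ × ℝ) × (ℤ × ℝ × ℝ) | w.1.2 ∈ trawlAt A t} :=
    fun t => (measurable_snd.comp measurable_fst) (measurableSet_trawlAt hA t)
  have h2 : ∀ t : ℝ, MeasurableSet {w : (ℤ × ℝ × ℝ) × (ℤ × ℝ × ℝ) | w.2.2 ∈ trawlAt A t} :=
    fun t => (measurable_snd.comp measurable_snd) (measurableSet_trawlAt hA t)
  have hG1 : MeasurableSet {w : (ℤ × ℝ × ℝ) × (ℤ × ℝ × ℝ) | w.1.2.1 ∈ G} :=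
    (measurable_fst.comp (measurable_snd.comp measurable_fst)) hG
  have hG2 : MeasurableSet {w : (ℤ × ℝ × ℝ) × (ℤ × ℝ × ℝ) | w.2.2.1 ∈ G} :=
    (measurable_fst.comp (measurable_snd.comp measurable_snd)) hG
  have : commonSwitchSet A G M = ({w | w.1.2.1 ∈ G} ∩ {w | w.2.2.1 ∈ G}) ∩
      ⋂ n : ℕ, ⋃ a : ℚ, ⋃ b : ℚ,
        {_w | 0 ≤ (a : ℝ) ∧ (a : ℝ) < b ∧ (b : ℝ) ≤ M ∧ (b : ℝ) - a < 1 / (n + 1 : ℝ)} ∩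
        ({w | ¬ (w.1.2 ∈ trawlAt A a ↔ w.1.2 ∈ trawlAt A b)} ∩
          {w | ¬ (w.2.2 ∈ trawlAt A a ↔ w.2.2 ∈ trawlAt A b)}) := by
    ext w
    simp only [commonSwitchSet, Set.mem_inter_iff, Set.mem_iInter, Set.mem_iUnion,
      Set.mem_ofPred_eq]
  rw [this]
  exact (hG1.inter hG2).inter (MeasurableSet.iInter fun n => MeasurableSet.iUnion fun a =>
    MeasurableSet.iUnion fun b => (MeasurableSet.const _).inter
      (((h1 a).iff (h1 b)).compl.inter ((h2 a).iff (h2 b)).compl))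

lemma mem_commonSwitchSet {A : Set (ℝ × ℝ)} {G : Set ℝ} (hGA : ∀ x ∈ G, IsRegularHeight A x)
    {p q : ℤ × ℝ × ℝ} (hp : p.2.1 ∈ G) (hq : q.2.1 ∈ G) {t : ℝ} (ht : 0 < t) {M : ℕ} (htM : t < M)
    (htp : t ∈ switchTimes A p.2) (htq : t ∈ switchTimes A q.2) :
    (p, q) ∈ commonSwitchSet A G M := by
  obtain ⟨a₁, ha₁, b₁, hb₁, h₁⟩ := (hGA _ hp).exists_separated_of_mem_switchTimes htp
  obtain ⟨a₂, ha₂, b₂, hb₂, h₂⟩ := (hGA _ hq).exists_separated_of_mem_switchTimes htq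
  refine ⟨⟨hp, hq⟩, fun n => ?_⟩
  have hpos : (0 : ℝ) < 1 / (n + 1 : ℝ) := by positivity
  obtain ⟨a, ha, hat⟩ := exists_rat_btwn
    (show max (max a₁ a₂) (max 0 (t - 1 / (n + 1 : ℝ) / 2)) < t by
      simp only [max_lt_iff]; exact ⟨⟨ha₁, ha₂⟩, ht, by linarith⟩)
  obtain ⟨b, htb, hb⟩ := exists_rat_btwn
    (show t < min (min b₁ b₂) (min (M : ℝ) (t + 1 / (n + 1 : ℝ) / 2)) by
      simp only [lt_min_iff]; exact ⟨⟨hb₁, hb₂⟩, htM, by linarith⟩)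
  simp only [max_lt_iff] at ha
  simp only [lt_min_iff] at hb
  exact ⟨a, b, ⟨ha.2.1.le, hat.trans htb, hb.2.1.le, by linarith [ha.2.2, hb.2.2]⟩,
    h₁ a ⟨ha.1.1, hat⟩ b ⟨htb, hb.1.1⟩, h₂ a ⟨ha.1.2, hat⟩ b ⟨htb, hb.1.2⟩⟩

/-- By compactness the shrinking intervals accumulate at some `t`; presence that is constant near
`t` could not differ at the endpoints of intervals close to `t`. -/
lemma exists_switch_of_mem_commonSwitchSet {A : Set (ℝ × ℝ)} {G : Set ℝ} {M : ℕ}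
    {p q : ℤ × ℝ × ℝ} (h : (p, q) ∈ commonSwitchSet A G M) :
    ∃ t, t ∈ switchTimes A p.2 ∧ t ∈ switchTimes A q.2 := by
  choose a b hab hp hq using h.2
  obtain ⟨t, -, φ, hφ, hlim⟩ := isCompact_Icc.tendsto_subseq (x := fun n => (a n : ℝ))
    (s := Set.Icc (0 : ℝ) M) (fun n => ⟨(hab n).1, (hab n).2.1.le.trans (hab n).2.2.1⟩)
  have hd : Tendsto (fun n => (b n : ℝ) - a n) atTop (𝓝 0) :=
    squeeze_zero (fun n => sub_nonneg.2 (hab n).2.1.le) (fun n => (hab n).2.2.2.le)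
      tendsto_one_div_add_atTop_nhds_zero_nat
  have hlimb : Tendsto (fun n => (b (φ n) : ℝ)) atTop (𝓝 t) := by
    have := hlim.add (hd.comp hφ.tendsto_atTop)
    simpa [Function.comp_def] using this
  have key : ∀ z : ℝ × ℝ, (∀ n, ¬ (z ∈ trawlAt A (a n) ↔ z ∈ trawlAt A (b n))) →
      t ∈ switchTimes A z := by
    intro z hz hev
    obtain ⟨n, h1, h2⟩ := ((hlim.eventually hev).and (hlimb.eventually hev)).exists
    exact hz (φ n) (h1.trans h2.symm)
  exact ⟨t, key _ hp, key _ hq⟩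

lemma sub_mem_switchTimes {A : Set (ℝ × ℝ)} {x s t : ℝ} (h : t ∈ switchTimes A (x, s)) :
    t - s ∈ switchTimes A (x, 0) := by
  intro hev
  refine h ?_
  have hlim : Tendsto (fun u : ℝ => u - s) (𝓝 t) (𝓝 (t - s)) :=
    (continuous_id.sub continuous_const).tendsto t
  refine (hlim.eventually hev).mono fun u hu => ?_
  simpa only [mem_trawlAt, zero_sub, neg_sub] using hu

/-- Fubini, with the first event and the size and height of the second fixed. The time of the second
event must then be a difference of two elements of countable sets, hence lies in a Lebesgue null
set. -/
lemma prod_commonSwitchSet_eq_zero {A : Set (ℝ × ℝ)} (hA : MeasurableSet A) {G : Set ℝ}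
    (hG : MeasurableSet G) (hGA : ∀ x ∈ G, IsRegularHeight A x) (M : ℕ) (ν : Measure ℤ)
    [IsFiniteMeasure ν] (U V : Set (ℤ × ℝ × ℝ)) :
    (((basisIntensity ν).restrict U).prod ((basisIntensity ν).restrict V))
      (commonSwitchSet A G M) = 0 := by
  have : SFinite (basisIntensity ν) := by unfold basisIntensity; infer_instance
  have hC := measurableSet_commonSwitchSet hA hG M
  refine Measure.measure_prod_null_of_ae_null hC (ae_of_all _ fun p => ?_)
  refine le_antisymm ((Measure.restrict_apply_le _ _).trans (le_of_eq ?_)) (zero_le (a := _))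
  have hC1 : MeasurableSet (Prod.mk p ⁻¹' commonSwitchSet A G M) := measurable_prodMk_left hC
  refine Measure.measure_prod_null_of_ae_null hC1 (ae_of_all _ fun y => ?_)
  have hC2 := measurable_prodMk_left (x := y) hC1
  refine Measure.measure_prod_null_of_ae_null hC2 (ae_of_all _ fun x => ?_)
  refine Set.Countable.measure_zero ?_ volume
  by_cases hx : p.2.1 ∈ G ∧ x ∈ G
  · have h1 := (hGA _ hx.1).countable_switchTimes (z := p.2)
    have h2 := (hGA _ hx.2).countable_switchTimes (z := (x, 0))
    refine (h1.image2 h2 (fun t d => t - d)).mono fun s hs => ?_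
    obtain ⟨t, ht, ht2⟩ := exists_switch_of_mem_commonSwitchSet hs
    exact ⟨t, ht, t - s, sub_mem_switchTimes ht2, by ring⟩
  · convert Set.countable_empty
    refine Set.eq_empty_of_forall_notMem fun s hs => hx hs.1

/-! ### Simple points, distinct event times and distinct switch times. -/

lemma basisIntensity_slab (ν : Measure ℤ) [IsFiniteMeasure ν] (I : Set ℝ) :
    basisIntensity ν (Set.univ ×ˢ Set.univ ×ˢ I) = ν Set.univ * volume I := by
  unfold basisIntensity
  rw [Measure.prod_prod, Measure.prod_prod, Measure.restrict_apply_univ]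
  simp

section

variable {Ω : Type*} [MeasurableSpace Ω] {P : Measure Ω} {ν : Measure ℤ} [IsFiniteMeasure ν]
  {N : Ω → Measure (ℤ × ℝ × ℝ)}

lemma measurableSet_slab {I : Set ℝ} (hI : MeasurableSet I) :
    MeasurableSet ((Set.univ : Set ℤ) ×ˢ (Set.univ : Set ℝ) ×ˢ I) :=
  MeasurableSet.univ.prod (MeasurableSet.univ.prod hI)

/-- Cut the unit interval into `n + 1` equal pieces: two simultaneous events lie in one piece, which
has probability at most `(n + 1) (c / (n + 1))^2 = c^2 / (n + 1)`. -/
lemma measure_exists_two_le_slab_eq_zero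
    (hN : IsPoissonRandomMeasure N (basisIntensity ν) P) (m : ℤ) :
    P {ω | ∃ s ∈ Set.Ioc (m : ℝ) (m + 1), 2 ≤ N ω (Set.univ ×ˢ Set.univ ×ˢ {s})} = 0 := by
  have hcν : ν Set.univ ≠ ⊤ := measure_ne_top _ _
  set c : ℝ := (ν Set.univ).toReal
  have hbound : ∀ n : ℕ, P {ω | ∃ s ∈ Set.Ioc (m : ℝ) (m + 1),
      2 ≤ N ω (Set.univ ×ˢ Set.univ ×ˢ {s})} ≤ ENNReal.ofReal (c ^ 2 * (1 / (n + 1 : ℝ))) := by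
    intro n
    let I : ℕ → Set ℝ := fun i => Set.Ioc (m + i / (n + 1 : ℝ)) (m + (i + 1) / (n + 1 : ℝ))
    have hI : ∀ i, basisIntensity ν (Set.univ ×ˢ Set.univ ×ˢ I i) =
        ENNReal.ofReal (c * (1 / (n + 1 : ℝ))) := by
      intro i
      rw [basisIntensity_slab, Real.volume_Ioc, ENNReal.ofReal_mul ENNReal.toReal_nonneg,
        ENNReal.ofReal_toReal hcν]
      congr 2
      ring
    have hsub : {ω | ∃ s ∈ Set.Ioc (m : ℝ) (m + 1), 2 ≤ N ω (Set.univ ×ˢ Set.univ ×ˢ {s})} ⊆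
        ⋃ i ∈ Finset.range (n + 1), {ω | 2 ≤ N ω (Set.univ ×ˢ Set.univ ×ˢ I i)} := by
      rintro ω ⟨s, hs, h2⟩
      have hpos : (0 : ℝ) < (s - m) * (n + 1) := mul_pos (sub_pos.2 hs.1) (by positivity)
      have hle : (s - m) * (n + 1) ≤ ((n + 1 : ℕ) : ℝ) := by
        have : s - m ≤ 1 := by linarith [hs.2]
        push_cast
        nlinarith [Nat.cast_nonneg (α := ℝ) n]
      obtain ⟨j, hj⟩ : ∃ j, ⌈(s - m) * (n + 1)⌉₊ = j + 1 :=
        Nat.exists_eq_succ_of_ne_zero (Nat.ceil_pos.2 hpos).ne'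
      have hj1 : j + 1 ≤ n + 1 := hj ▸ Nat.ceil_le.2 hle
      have hj2 := Nat.le_ceil ((s - m) * (n + 1 : ℝ))
      have hj3 := Nat.ceil_lt_add_one hpos.le
      rw [hj] at hj2 hj3
      push_cast at hj2 hj3
      refine Set.mem_biUnion (x := j) (by simpa using hj1) ?_
      refine h2.trans (measure_mono ?_)
      refine Set.prod_mono_right (Set.prod_mono_right ?_)
      rw [Set.singleton_subset_iff]
      have hn : (0 : ℝ) < n + 1 := by positivity
      constructor
      · rw [← lt_sub_iff_add_lt', div_lt_iff₀ hn]
        linarith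
      · rw [← sub_le_iff_le_add', le_div_iff₀ hn]
        linarith
    refine (measure_mono hsub).trans ((measure_biUnion_finset_le _ _).trans ?_)
    refine (Finset.sum_le_sum fun i _ =>
      hN.measure_two_le (measurableSet_slab measurableSet_Ioc) (by rw [hI]; simp)).trans ?_
    rw [Finset.sum_congr rfl fun i _ => by rw [hI i], Finset.sum_const, Finset.card_range, nsmul_eq_mul, ← ENNReal.ofReal_natCast,
      ← ENNReal.ofReal_pow (by positivity), ← ENNReal.ofReal_mul (by positivity)]
    refine ENNReal.ofReal_le_ofReal (le_of_eq ?_)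
    push_cast
    field_simp
  have hlim : Tendsto (fun n : ℕ => ENNReal.ofReal (c ^ 2 * (1 / (n + 1 : ℝ)))) atTop (𝓝 0) := by
    have h := (tendsto_one_div_add_atTop_nhds_zero_nat (𝕜 := ℝ)).const_mul (c ^ 2)
    have h2 := (ENNReal.continuous_ofReal.tendsto _).comp h
    simpa [Function.comp_def] using h2
  exact le_antisymm (ge_of_tendsto' hlim hbound) (zero_le (a := _))

lemma ae_slab_le_one (hN : IsPoissonRandomMeasure N (basisIntensity ν) P) :
    ∀ᵐ ω ∂P, ∀ s : ℝ, N ω (Set.univ ×ˢ Set.univ ×ˢ {s}) ≤ 1 := by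
  have h : ∀ᵐ ω ∂P, ∀ m : ℤ, ¬ ∃ s ∈ Set.Ioc (m : ℝ) (m + 1),
      2 ≤ N ω (Set.univ ×ˢ Set.univ ×ˢ {s}) := by
    rw [ae_all_iff]
    intro m
    rw [ae_iff]
    simpa only [not_not] using measure_exists_two_le_slab_eq_zero hN m
  filter_upwards [h] with ω hω s
  obtain ⟨k, hk⟩ := hN.integer_valued ω _ (measurableSet_slab (measurableSet_singleton s))
  have hlt : N ω (Set.univ ×ˢ Set.univ ×ˢ {s}) < 2 := by
    rw [← not_le]
    refine fun h2 => hω (⌈s⌉ - 1) ⟨s, ⟨?_, ?_⟩, h2⟩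
    · push_cast
      linarith [Int.ceil_lt_add_one s]
    · push_cast
      linarith [Int.le_ceil s]
  rw [hk] at hlt ⊢
  have hlt' : k < 2 := by exact_mod_cast hlt
  have : k ≤ 1 := Order.le_of_lt_add_one (by rwa [one_add_one_eq_two])
  exact_mod_cast this

/-- Almost surely every point of the Poisson random measure is simple. -/
lemma ae_singleton_eq_one (hN : IsPoissonRandomMeasure N (basisIntensity ν) P) :
    ∀ᵐ ω ∂P, ∀ p, N ω {p} ≠ 0 → N ω {p} = 1 := by
  filter_upwards [ae_slab_le_one hN] with ω hω p hp
  obtain ⟨k, hk⟩ := hN.integer_valued ω _ (measurableSet_singleton p)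
  refine le_antisymm ((measure_mono ?_).trans (hω p.2.2)) ?_
  · rintro q rfl
    exact ⟨trivial, trivial, rfl⟩
  · rw [hk] at hp ⊢
    have : 1 ≤ k := Order.one_le_iff_ne_zero.2 (by rintro rfl; simp at hp)
    exact_mod_cast this

/-- Almost surely the events occur at different times. -/
lemma ae_time_ne (hN : IsPoissonRandomMeasure N (basisIntensity ν) P) :
    ∀ᵐ ω ∂P, ∀ p q, N ω {p} ≠ 0 → N ω {q} ≠ 0 → p ≠ q → p.2.2 ≠ q.2.2 := by
  filter_upwards [ae_slab_le_one hN, ae_singleton_eq_one hN] with ω hω h1 p q hp hq hpq hs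
  have h := (measure_mono (μ := N ω) (s := {p} ∪ {q}) ?_).trans (hω p.2.2)
  · rw [measure_union (by simpa using hpq) (measurableSet_singleton q), h1 p hp, h1 q hq]
      at h
    norm_num at h
  · rintro r (rfl | rfl)
    · exact ⟨trivial, trivial, rfl⟩
    · exact ⟨trivial, trivial, hs.symm⟩

/-- Almost surely no two events at regular heights enter or leave the trawl at the same time. -/
lemma ae_disjoint_switchTimes [IsProbabilityMeasure P]
    (hN : IsPoissonRandomMeasure N (basisIntensity ν) P) {A : Set (ℝ × ℝ)} (hA : MeasurableSet A)
    {G : Set ℝ} (hG : MeasurableSet G) (hGA : ∀ x ∈ G, IsRegularHeight A x) :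
    ∀ᵐ ω ∂P, ∀ p q, N ω {p} ≠ 0 → N ω {q} ≠ 0 → p.2.1 ∈ G → q.2.1 ∈ G → p ≠ q →
      ∀ t, 0 < t → t ∈ switchTimes A p.2 → t ∉ switchTimes A q.2 := by
  -- Events at different times are separated by a rational `r`, so countably many pairs of disjoint
  -- slabs of finite intensity cover all pairs of events.
  have hnull : ∀ᵐ ω ∂P, ∀ (r : ℚ) (M : ℕ),
      ∀ p ∈ (Set.univ : Set ℤ) ×ˢ (Set.univ : Set ℝ) ×ˢ Set.Ioo (-M : ℝ) r,
      ∀ q ∈ (Set.univ : Set ℤ) ×ˢ (Set.univ : Set ℝ) ×ˢ Set.Ioo (r : ℝ) M,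
      (p, q) ∈ commonSwitchSet A G M → N ω {p} = 0 ∨ N ω {q} = 0 := by
    simp_rw [ae_all_iff (ι := ℚ), ae_all_iff (ι := ℕ)]
    intro r M
    have hfin : ∀ a b : ℝ, basisIntensity ν (Set.univ ×ˢ Set.univ ×ˢ Set.Ioo a b) ≠ ⊤ := by
      intro a b
      rw [basisIntensity_slab, Real.volume_Ioo]
      exact ENNReal.mul_ne_top (measure_ne_top _ _) ENNReal.ofReal_ne_top
    refine hN.ae_not_mem_of_prod_null (measurableSet_slab measurableSet_Ioo)
      (measurableSet_slab measurableSet_Ioo) ?_ (hfin _ _) (hfin _ _)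
      (measurableSet_commonSwitchSet hA hG M) (prod_commonSwitchSet_eq_zero hA hG hGA M ν _ _)
    rw [Set.disjoint_left]
    rintro p hp hq
    exact absurd hp.2.2.2 (not_lt.2 hq.2.2.1.le)
  filter_upwards [hnull, ae_time_ne hN] with ω hω htime
  have key : ∀ p q, N ω {p} ≠ 0 → N ω {q} ≠ 0 → p.2.1 ∈ G → q.2.1 ∈ G → p.2.2 < q.2.2 →
      ∀ t, 0 < t → t ∈ switchTimes A p.2 → t ∉ switchTimes A q.2 := by
    intro p q hp hq hpG hqG hlt t ht htp htq
    obtain ⟨r, hr1, hr2⟩ := exists_rat_btwn hlt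
    obtain ⟨M, hM⟩ := exists_nat_gt (max (max (-p.2.2) q.2.2) t)
    simp only [max_lt_iff] at hM
    have h := hω r M p ⟨trivial, trivial, by linarith [hM.1.1], hr1⟩ q
      ⟨trivial, trivial, hr2, hM.1.2⟩ (mem_commonSwitchSet hGA hpG hqG ht hM.2 htp htq)
    exact h.elim hp hq
  intro p q hp hq hpG hqG hpq t ht htp htq
  rcases lt_or_gt_of_ne (htime p q hp hq hpq) with h | h
  · exact key p q hp hq hpG hqG h t ht htp htq
  · exact key q p hq hp hqG hpG h t ht htq htp

end

/-! ### Intensity of trawls and of swept regions. -/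

lemma restrict_prod_volume_eq :
    ((volume : Measure ℝ).restrict (Set.Icc 0 1)).prod (volume : Measure ℝ) =
      (volume : Measure (ℝ × ℝ)).restrict (Set.Icc 0 1 ×ˢ Set.univ) := by
  conv_lhs => rw [← Measure.restrict_univ (μ := (volume : Measure ℝ)), Measure.restrict_restrict
    measurableSet_Icc, Set.inter_univ, Measure.prod_restrict]
  rfl

lemma basisIntensity_prod_le (ν : Measure ℤ) [IsFiniteMeasure ν] (K : Set ℤ) (B : Set (ℝ × ℝ)) :
    basisIntensity ν (K ×ˢ B) ≤ ν K * volume B := by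
  unfold basisIntensity
  rw [Measure.prod_prod, restrict_prod_volume_eq]
  gcongr
  exact Measure.restrict_le_self

lemma basisIntensity_prod_eq (ν : Measure ℤ) [IsFiniteMeasure ν] (K : Set ℤ) {B : Set (ℝ × ℝ)}
    (hB : MeasurableSet B) (hsub : B ⊆ Set.Icc 0 1 ×ˢ Set.univ) :
    basisIntensity ν (K ×ˢ B) = ν K * volume B := by
  unfold basisIntensity
  rw [Measure.prod_prod, restrict_prod_volume_eq, Measure.restrict_apply hB,
    Set.inter_eq_left.2 hsub]

lemma volume_trawlAt (A : Set (ℝ × ℝ)) (t : ℝ) : volume (trawlAt A t) = volume A := by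
  have h : trawlAt A t = (fun z : ℝ × ℝ => z + (0, -t)) ⁻¹' A := by
    ext z
    rw [mem_trawlAt, Set.mem_preimage]
    simp [Prod.add_def, sub_eq_add_neg]
  rw [h, measure_preimage_add_right]

lemma trawlAt_zero (A : Set (ℝ × ℝ)) : trawlAt A 0 = A := by
  ext z
  rw [mem_trawlAt, sub_zero]

namespace IsTrawl

variable {A : Set (ℝ × ℝ)}

lemma volume_ne_top (hA : IsTrawl A) : volume A ≠ ⊤ := by
  refine ne_top_of_le_ne_top (hA.finite_swept 0).ne (measure_mono fun z hz => ?_)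
  exact Set.mem_biUnion (x := (0 : ℝ)) ⟨le_rfl, le_rfl⟩ (by rwa [trawlAt_zero])

lemma trawlAt_subset (hA : IsTrawl A) (t : ℝ) : trawlAt A t ⊆ Set.Icc 0 1 ×ˢ Set.univ :=
  fun _ hz => ⟨(hA.subset hz).1, trivial⟩

lemma basisIntensity_trawlAt (hA : IsTrawl A) (ν : Measure ℤ) [IsFiniteMeasure ν] (K : Set ℤ)
    (t : ℝ) : basisIntensity ν (K ×ˢ trawlAt A t) = ν K * volume A := by
  rw [basisIntensity_prod_eq ν K (measurableSet_trawlAt hA.measurableSet t) (hA.trawlAt_subset t),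
    volume_trawlAt]

lemma basisIntensity_trawlAt_ne_top (hA : IsTrawl A) (ν : Measure ℤ) [IsFiniteMeasure ν]
    (K : Set ℤ) (t : ℝ) : basisIntensity ν (K ×ˢ trawlAt A t) ≠ ⊤ := by
  rw [hA.basisIntensity_trawlAt]
  exact ENNReal.mul_ne_top (measure_ne_top _ _) hA.volume_ne_top

end IsTrawl

/-- The events at heights in `G` that lie in the trawl at some rational time in `[0, n]`. -/
def sweptSet (A : Set (ℝ × ℝ)) (G : Set ℝ) (n : ℕ) : Set (ℤ × ℝ × ℝ) :=
  {p | p.2.1 ∈ G ∧ ∃ q : ℚ, 0 ≤ (q : ℝ) ∧ (q : ℝ) ≤ n ∧ p.2 ∈ trawlAt A q}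

lemma measurableSet_sweptSet {A : Set (ℝ × ℝ)} (hA : MeasurableSet A) {G : Set ℝ}
    (hG : MeasurableSet G) (n : ℕ) : MeasurableSet (sweptSet A G n) := by
  have h : sweptSet A G n = {p | p.2.1 ∈ G} ∩ ⋃ q : ℚ,
      {_p | 0 ≤ (q : ℝ)} ∩ ({_p | (q : ℝ) ≤ n} ∩ {p | p.2 ∈ trawlAt A q}) := by
    ext p
    simp only [sweptSet, Set.mem_inter_iff, Set.mem_iUnion, Set.mem_ofPred_eq]
  rw [h]
  exact ((measurable_fst.comp measurable_snd) hG).inter (MeasurableSet.iUnion fun q =>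
    (MeasurableSet.const _).inter ((MeasurableSet.const _).inter
      (measurable_snd (measurableSet_trawlAt hA q))))

lemma basisIntensity_sweptSet_ne_top {A : Set (ℝ × ℝ)} (hA : IsTrawl A) (G : Set ℝ) (n : ℕ)
    (ν : Measure ℤ) [IsFiniteMeasure ν] : basisIntensity ν (sweptSet A G n) ≠ ⊤ := by
  refine ne_top_of_le_ne_top (ENNReal.mul_ne_top (measure_ne_top ν Set.univ)
    (hA.finite_swept n).ne) ((measure_mono ?_).trans (basisIntensity_prod_le ν _ _))
  rintro p ⟨-, q, hq0, hqn, hp⟩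
  exact ⟨trivial, Set.mem_biUnion (x := (q : ℝ)) ⟨hq0, hqn⟩ hp⟩

/-- Right-constancy keeps the event in the trawl until some rational time; rational times make the
swept set measurable. -/
lemma mem_sweptSet {A : Set (ℝ × ℝ)} {G : Set ℝ} (hGA : ∀ x ∈ G, IsRegularHeight A x)
    {p : ℤ × ℝ × ℝ} (hp : p.2.1 ∈ G) {t : ℝ} (ht : 0 ≤ t) {n : ℕ} (htn : t < n)
    (hpt : p.2 ∈ trawlAt A t) : p ∈ sweptSet A G n := by
  obtain ⟨b, hb, hbs⟩ :=
    mem_nhdsGT_iff_exists_Ioo_subset.1 ((hGA _ hp).eventually_right (z := p.2) t)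
  obtain ⟨q, hq1, hq2⟩ := exists_rat_btwn (lt_min hb htn)
  have h := hbs ⟨hq1, hq2.trans_le (min_le_left _ _)⟩
  exact ⟨hp, q, ht.trans hq1.le, (hq2.trans_le (min_le_right _ _)).le, h.2 hpt⟩

/-! ### Positive sizes and emptying of the trawl. -/

section

variable {Ω : Type*} [MeasurableSpace Ω] {P : Measure Ω} [IsProbabilityMeasure P] {ν : Measure ℤ}
  [IsFiniteMeasure ν] {N : Ω → Measure (ℤ × ℝ × ℝ)} {A : Set (ℝ × ℝ)}

/-- A non-negative trawl process with a trawl of positive area has no negative events. -/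
lemma measure_singleton_eq_zero_of_nonneg (hN : IsPoissonRandomMeasure N (basisIntensity ν) P)
    (hA : IsTrawl A) (hA0 : volume A ≠ 0) (hnonneg : ∀ᵐ ω ∂P, 0 ≤ trawlProcess N A ω 0)
    {k : ℤ} (hk : k < 0) : ν {k} = 0 := by
  by_contra hνk
  have hm : ∀ K : Set ℤ, MeasurableSet (K ×ˢ trawlAt A 0) := fun K =>
    (MeasurableSet.of_discrete).prod (measurableSet_trawlAt hA.measurableSet 0)
  have hd : Disjoint (({k} : Set ℤ) ×ˢ trawlAt A 0) (({k} : Set ℤ)ᶜ ×ˢ trawlAt A 0) := by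
    rw [Set.disjoint_left]
    rintro p hp hq
    exact hq.1 hp.1
  -- Consider the event of exactly one point of size `k` and none of any other size in the initial
  -- trawl. Its probability is a product of two positive factors, yet on it `Y_0 = k < 0`.
  have hind := (hN.indepFun_pair (hm {k}) (hm {k}ᶜ) hd).measure_inter_preimage_eq_mul {1} {0}
    (measurableSet_singleton _) (measurableSet_singleton _)
  have h1 : P ((fun ω => N ω (({k} : Set ℤ) ×ˢ trawlAt A 0)) ⁻¹' {1}) ≠ 0 := by
    have h := hN.measure_eq_natCast (hm {k}) (hA.basisIntensity_trawlAt_ne_top ν {k} 0) 1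
    rw [Nat.cast_one] at h
    change P {ω | N ω (({k} : Set ℤ) ×ˢ trawlAt A 0) = 1} ≠ 0
    rw [h, poissonMeasure_singleton]
    have hpos : 0 < (basisIntensity ν (({k} : Set ℤ) ×ˢ trawlAt A 0)).toNNReal := by
      refine ENNReal.toNNReal_pos ?_ (hA.basisIntensity_trawlAt_ne_top ν {k} 0)
      rw [hA.basisIntensity_trawlAt]
      exact mul_ne_zero hνk hA0
    refine (ENNReal.ofReal_pos.2 ?_).ne'
    have : (0 : ℝ) < ((basisIntensity ν (({k} : Set ℤ) ×ˢ trawlAt A 0)).toNNReal : ℝ) := hpos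
    positivity
  have h2 : P ((fun ω => N ω (({k} : Set ℤ)ᶜ ×ˢ trawlAt A 0)) ⁻¹' {0}) ≠ 0 := by
    have h := hN.measure_eq_natCast (hm {k}ᶜ) (hA.basisIntensity_trawlAt_ne_top ν {k}ᶜ 0) 0
    rw [Nat.cast_zero] at h
    change P {ω | N ω (({k} : Set ℤ)ᶜ ×ˢ trawlAt A 0) = 0} ≠ 0
    rw [h, poissonMeasure_singleton]
    refine (ENNReal.ofReal_pos.2 ?_).ne'
    positivity
  refine mul_ne_zero h1 h2 (hind ▸ ?_)
  refine measure_mono_null ?_ (ae_iff.1 hnonneg)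
  rintro ω ⟨hω1, hω2⟩
  have hω1' : N ω (({k} : Set ℤ) ×ˢ trawlAt A 0) = 1 := hω1
  have hω2' : N ω (({k} : Set ℤ)ᶜ ×ˢ trawlAt A 0) = 0 := hω2
  have hset : ((Set.univ : Set ℤ) ×ˢ trawlAt A 0 : Set (ℤ × ℝ × ℝ)) =ᵐ[N ω]
      (({k} : Set ℤ) ×ˢ trawlAt A 0 : Set (ℤ × ℝ × ℝ)) := by
    have hu : ((Set.univ : Set ℤ) ×ˢ trawlAt A 0 : Set (ℤ × ℝ × ℝ)) =
        ({k} : Set ℤ) ×ˢ trawlAt A 0 ∪ ({k} : Set ℤ)ᶜ ×ˢ trawlAt A 0 := by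
      rw [← Set.union_prod, Set.union_compl_self]
    rw [hu]
    exact union_ae_eq_left_of_ae_eq_empty (ae_eq_empty.2 hω2')
  have hval : trawlProcess N A ω 0 = k := by
    rw [trawlProcess, levyBasis, setIntegral_congr_set hset,
      setIntegral_congr_fun (g := fun _ => (k : ℝ)) (hm {k})
        (fun p hp => by simp only; rw [Set.mem_singleton_iff.1 hp.1]),
      setIntegral_const, measureReal_def, hω1']
    simp
  change ¬ 0 ≤ trawlProcess N A ω 0
  rw [hval, not_le]
  exact_mod_cast hk

/-- For a non-negative trawl process, almost surely every event that is ever in the trawl at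
a regular height has positive size. -/
lemma ae_sweptSet_pos (hν : ν {0} = 0) (hN : IsPoissonRandomMeasure N (basisIntensity ν) P)
    (hA : IsTrawl A) (hnonneg : ∀ᵐ ω ∂P, 0 ≤ trawlProcess N A ω 0) (G : Set ℝ) :
    ∀ᵐ ω ∂P, ∀ n p, p ∈ sweptSet A G n → N ω {p} ≠ 0 → 0 < p.1 := by
  by_cases hA0 : volume A = 0
  -- With zero area `ν` may charge negative sizes, but the trawl is almost surely empty at all
  -- rational times, so no event is ever swept.
  · have h : ∀ᵐ ω ∂P, ∀ q : ℚ, N ω (Set.univ ×ˢ trawlAt A q) = 0 := by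
      rw [ae_all_iff]
      intro q
      refine hN.ae_eq_zero (MeasurableSet.univ.prod
        (measurableSet_trawlAt hA.measurableSet q)) ?_
      rw [hA.basisIntensity_trawlAt, hA0, mul_zero]
    filter_upwards [h] with ω hω n p hp hNp
    obtain ⟨-, q, -, -, hq⟩ := hp
    refine absurd (measure_mono_null ?_ (hω q)) hNp
    rintro r rfl
    exact ⟨trivial, hq⟩
  · have hle : ν (Set.Iic 0) = 0 := by
      rw [← Set.biUnion_of_singleton (Set.Iic (0 : ℤ)),
        measure_biUnion_null_iff (Set.to_countable _)]
      intro k hk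
      rcases (show k ≤ 0 from hk).eq_or_lt with h | h
      · rw [h, hν]
      · exact measure_singleton_eq_zero_of_nonneg hN hA hA0 hnonneg h
    have h := hN.ae_eq_zero (B := Set.Iic 0 ×ˢ Set.univ)
      (MeasurableSet.of_discrete.prod MeasurableSet.univ)
      (le_antisymm ((basisIntensity_prod_le ν _ _).trans (by rw [hle, zero_mul])) (zero_le (a := _)))
    filter_upwards [h] with ω hω n p _ hNp
    by_contra hp
    refine hNp (measure_mono_null ?_ hω)
    rintro r rfl
    exact ⟨not_lt.1 hp, trivial⟩

/-- Almost surely the trawl is at some time free of events of size `k`. -/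
lemma ae_exists_count_eq_zero (hN : IsPoissonRandomMeasure N (basisIntensity ν) P)
    (hA : IsTrawl A) (k : ℤ) :
    ∀ᵐ ω ∂P, ∃ t : ℝ, 0 ≤ t ∧ N ω ({k} ×ˢ trawlAt A t) = 0 := by
  -- Only the part of age less than `M` has disjoint translates at the times `i * M`; the older part
  -- has small area for large `M`.
  let near : ℕ → Set (ℝ × ℝ) := fun M => A ∩ {z | -(M : ℝ) < z.2}
  let far : ℕ → Set (ℝ × ℝ) := fun M => A ∩ {z | z.2 ≤ -(M : ℝ)}
  have hnear : ∀ M, MeasurableSet (near M) := fun M =>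
    hA.measurableSet.inter (measurableSet_lt measurable_const measurable_snd)
  have hfar : ∀ M, MeasurableSet (far M) := fun M =>
    hA.measurableSet.inter (measurableSet_le measurable_snd measurable_const)
  have hprodm : ∀ {B : Set (ℝ × ℝ)} (t : ℝ), MeasurableSet B →
      MeasurableSet (({k} : Set ℤ) ×ˢ trawlAt B t) := fun t hB =>
    (measurableSet_singleton k).prod (measurableSet_trawlAt hB t)
  have hle : ∀ (B : Set (ℝ × ℝ)) (t : ℝ),
      basisIntensity ν (({k} : Set ℤ) ×ˢ trawlAt B t) ≤ ν {k} * volume B := fun B t =>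
    (basisIntensity_prod_le ν _ _).trans (by rw [volume_trawlAt])
  have hfin : ∀ B ⊆ A, ∀ t : ℝ, basisIntensity ν (({k} : Set ℤ) ×ˢ trawlAt B t) ≠ ⊤ :=
    fun B hB t => ne_top_of_le_ne_top (ENNReal.mul_ne_top (measure_ne_top ν {k}) hA.volume_ne_top)
      ((hle B t).trans (by gcongr))
  set lam : ℝ≥0∞ := ν {k} * volume A with hlam
  have hlamtop : lam ≠ ⊤ := ENNReal.mul_ne_top (measure_ne_top ν {k}) hA.volume_ne_top
  -- One minus the probability that a full trawl is free of size `k`; it bounds the near parts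
  -- uniformly in `M`.
  set ρ : ℝ≥0∞ := 1 - ENNReal.ofReal (Real.exp (-lam.toReal)) with hρ
  have hρ1 : ρ < 1 := ENNReal.sub_lt_self ENNReal.one_ne_top one_ne_zero
    (ENNReal.ofReal_pos.2 (Real.exp_pos _)).ne'
  have hone : ∀ (M : ℕ) (t : ℝ), P {ω | N ω ({k} ×ˢ trawlAt (near M) t) ≠ 0} ≤ ρ := by
    intro M t
    have hm := hprodm t (hnear M)
    have hf := hfin (near M) Set.inter_subset_left t
    have h0 := hN.measure_eq_natCast hm hf 0
    have hms : MeasurableSet {ω | N ω ({k} ×ˢ trawlAt (near M) t) = 0} :=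
      hN.measurable_apply _ hm (measurableSet_singleton 0)
    rw [Nat.cast_zero] at h0
    have hc : {ω | N ω ({k} ×ˢ trawlAt (near M) t) ≠ 0} =
        {ω | N ω ({k} ×ˢ trawlAt (near M) t) = 0}ᶜ := rfl
    rw [hc, prob_compl_eq_one_sub hms, h0, poissonMeasure_singleton, hρ]
    refine tsub_le_tsub_left (ENNReal.ofReal_le_ofReal ?_) _
    rw [pow_zero, Nat.factorial_zero, Nat.cast_one, div_one, mul_one]
    refine Real.exp_le_exp.2 (neg_le_neg ?_)
    exact ENNReal.toReal_mono hlamtop ((hle _ t).trans (by rw [hlam]; gcongr; exact Set.inter_subset_left))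
  have hall : ∀ M n : ℕ, P {ω | ∀ i : Fin n,
      N ω ({k} ×ˢ trawlAt (near M) ((i : ℕ) * M : ℝ)) ≠ 0} ≤ ρ ^ n := by
    intro M n
    have hind := hN.indep n (fun i => {k} ×ˢ trawlAt (near M) ((i : ℕ) * M : ℝ))
      (fun i => hprodm _ (hnear M)) ?_
    · have h := hind.measure_inter_preimage_eq_mul Finset.univ (sets := fun _ => {0}ᶜ)
        (fun i _ => (measurableSet_singleton _).compl)
      have hset : {ω | ∀ i : Fin n, N ω ({k} ×ˢ trawlAt (near M) ((i : ℕ) * M : ℝ)) ≠ 0} =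
          ⋂ i ∈ (Finset.univ : Finset (Fin n)),
            (fun ω => N ω ({k} ×ˢ trawlAt (near M) ((i : ℕ) * M : ℝ))) ⁻¹' {0}ᶜ := by
        ext ω
        simp
      rw [hset, h]
      calc _ ≤ ∏ _i : Fin n, ρ := Finset.prod_le_prod' fun i _ => hone M _
        _ = ρ ^ n := by simp
    · have key : ∀ i j : Fin n, i < j →
          Disjoint (({k} : Set ℤ) ×ˢ trawlAt (near M) ((i : ℕ) * M : ℝ))
            (({k} : Set ℤ) ×ˢ trawlAt (near M) ((j : ℕ) * M : ℝ)) := by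
        intro i j hij
        rw [Set.disjoint_left]
        rintro p ⟨-, hp⟩ ⟨-, hq⟩
        have h1 : p.2.2 - (i : ℕ) * M ≤ 0 := (hA.subset hp.1).2
        have h2 : -(M : ℝ) < p.2.2 - (j : ℕ) * M := hq.2
        have h3 : ((i : ℕ) : ℝ) + 1 ≤ (j : ℕ) := by exact_mod_cast hij
        nlinarith [Nat.cast_nonneg (α := ℝ) M]
      intro i j hij
      rcases lt_or_gt_of_ne hij with h | h
      · exact key i j h
      · exact (key j i h).symm
  have hbound : ∀ n M : ℕ, P {ω | ¬ ∃ t : ℝ, 0 ≤ t ∧ N ω ({k} ×ˢ trawlAt A t) = 0} ≤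
      ρ ^ n + n * (ν {k} * volume (far M)) := by
    intro n M
    have hsub : {ω | ¬ ∃ t : ℝ, 0 ≤ t ∧ N ω ({k} ×ˢ trawlAt A t) = 0} ⊆
        {ω | ∀ i : Fin n, N ω ({k} ×ˢ trawlAt (near M) ((i : ℕ) * M : ℝ)) ≠ 0} ∪
          ⋃ i ∈ (Finset.univ : Finset (Fin n)),
            {ω | N ω ({k} ×ˢ trawlAt (far M) ((i : ℕ) * M : ℝ)) ≠ 0} := by
      intro ω hω
      by_cases h : ∀ i : Fin n, N ω ({k} ×ˢ trawlAt (near M) ((i : ℕ) * M : ℝ)) ≠ 0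
      · exact Or.inl h
      · push Not at h
        obtain ⟨i, hi⟩ := h
        refine Or.inr (Set.mem_biUnion (Finset.mem_univ i) fun hi2 => hω ?_)
        refine ⟨(i : ℕ) * M, by positivity, measure_mono_null ?_ (measure_union_null hi hi2)⟩
        rintro p ⟨hp1, hp2⟩
        rcases lt_or_ge (-(M : ℝ)) (p.2.2 - (i : ℕ) * M) with h | h
        · exact Or.inl ⟨hp1, hp2, h⟩
        · exact Or.inr ⟨hp1, hp2, h⟩
    refine (measure_mono hsub).trans ((measure_union_le _ _).trans (add_le_add (hall M n) ?_))
    refine (measure_biUnion_finset_le _ _).trans ((Finset.sum_le_sum fun i _ =>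
      (hN.measure_ne_zero_le (hprodm _ (hfar M)) (hfin _ Set.inter_subset_left _)).trans
        (hle _ _)).trans ?_)
    rw [Finset.sum_const, Finset.card_univ, Fintype.card_fin, nsmul_eq_mul]
  have hfar0 : Tendsto (fun M => volume (far M)) atTop (𝓝 0) := by
    have h := tendsto_measure_iInter_atTop (μ := volume) (s := far)
      (fun M => (hfar M).nullMeasurableSet) ?_
      ⟨0, ne_top_of_le_ne_top hA.volume_ne_top (measure_mono Set.inter_subset_left)⟩
    · have he : ⋂ M, far M = ∅ := by
        refine Set.eq_empty_of_forall_notMem fun z hz => ?_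
        rw [Set.mem_iInter] at hz
        obtain ⟨M, hM⟩ := exists_nat_gt (-z.2)
        have := (hz M).2
        simp only [Set.mem_ofPred_eq] at this
        linarith
      rwa [he, measure_empty] at h
    · intro M M' hMM' z hz
      have h1 : (M : ℝ) ≤ M' := by exact_mod_cast hMM'
      have h2 : z.2 ≤ -(M' : ℝ) := hz.2
      exact ⟨hz.1, by simp only [Set.mem_ofPred_eq]; linarith⟩
  -- First `M → ∞` with `n` fixed, which removes the far parts; only afterwards `n → ∞`.
  have hpow : ∀ n : ℕ, P {ω | ¬ ∃ t : ℝ, 0 ≤ t ∧ N ω ({k} ×ˢ trawlAt A t) = 0} ≤ ρ ^ n := by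
    intro n
    have h1 : Tendsto (fun M => ν {k} * volume (far M)) atTop (𝓝 (ν {k} * 0)) :=
      ENNReal.Tendsto.const_mul hfar0 (Or.inr (measure_ne_top _ _))
    have h2 : Tendsto (fun M => (n : ℝ≥0∞) * (ν {k} * volume (far M))) atTop
        (𝓝 (n * (ν {k} * 0))) :=
      ENNReal.Tendsto.const_mul h1 (Or.inr (ENNReal.natCast_ne_top n))
    have h3 := h2.const_add (ρ ^ n)
    rw [mul_zero, mul_zero, add_zero] at h3
    exact ge_of_tendsto' h3 (hbound n)
  rw [ae_iff]
  exact le_antisymm (ge_of_tendsto' (ENNReal.tendsto_pow_atTop_nhds_zero_of_lt_one hρ1) hpow)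
    (zero_le (a := _))

end

/-! ### Finite sums of step paths and of Dirac measures. -/

lemma jumpAt_congr {f g : ℝ → ℝ} {t : ℝ} (hg : ∃ l, ∀ᶠ u in 𝓝[<] t, g u = l)
    (h : ∀ᶠ u in 𝓝 t, f u = g u) : jumpAt f t = jumpAt g t := by
  obtain ⟨l, hl⟩ := hg
  have hf : ∀ᶠ u in 𝓝[<] t, f u = l := by
    filter_upwards [h.filter_mono nhdsWithin_le_nhds, hl] with u h1 h2
    rw [h1, h2]
  rw [jumpAt, jumpAt, leftLim_eq_of_eventually hf, leftLim_eq_of_eventually hl, h.self_of_nhds]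

namespace IsStepPath

lemma of_eq_on_bounded {Y : ℝ → ℝ}
    (h : ∀ n : ℕ, ∃ f, IsStepPath f ∧ ∀ t : ℝ, 0 ≤ t → t < n → Y t = f t) : IsStepPath Y where
  right t ht := by
    obtain ⟨n, hn⟩ := exists_nat_gt t
    obtain ⟨f, hf, hYf⟩ := h n
    filter_upwards [hf.right t ht, Ioo_mem_nhdsGT hn] with u hu hut
    rw [hYf u (ht.trans hut.1.le) hut.2, hu, hYf t ht hn]
  left t ht := by
    obtain ⟨n, hn⟩ := exists_nat_gt t
    obtain ⟨f, hf, hYf⟩ := h n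
    obtain ⟨l, hl⟩ := hf.left t ht
    refine ⟨l, ?_⟩
    filter_upwards [hl, Ioo_mem_nhdsLT ht] with u hu hut
    rw [hYf u hut.1.le (hut.2.trans hn), hu]

variable {ι : Type*} {F : Finset ι} {g : ι → ℝ → ℝ} (c : ι → ℝ) (hg : ∀ i ∈ F, IsStepPath (g i))

include hg

lemma sum_left {t : ℝ} (ht : 0 < t) : ∀ᶠ u in 𝓝[<] t,
    ∑ i ∈ F, c i * g i u = ∑ i ∈ F, c i * Function.leftLim (g i) t := by
  have h : ∀ᶠ u in 𝓝[<] t, ∀ i ∈ F, g i u = Function.leftLim (g i) t :=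
    (eventually_all_finset F).2 fun i hi => (hg i hi).left_leftLim ht
  filter_upwards [h] with u hu
  exact Finset.sum_congr rfl fun i hi => by rw [hu i hi]

lemma sum : IsStepPath (fun t => ∑ i ∈ F, c i * g i t) where
  right t ht := by
    have h : ∀ᶠ u in 𝓝[>] t, ∀ i ∈ F, g i u = g i t :=
      (eventually_all_finset F).2 fun i hi => (hg i hi).right t ht
    filter_upwards [h] with u hu
    exact Finset.sum_congr rfl fun i hi => by rw [hu i hi]
  left t ht := ⟨_, sum_left c hg ht⟩

lemma jumpAt_sum {t : ℝ} (ht : 0 < t) :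
    jumpAt (fun t => ∑ i ∈ F, c i * g i t) t = ∑ i ∈ F, c i * jumpAt (g i) t := by
  rw [jumpAt, leftLim_eq_of_eventually (sum_left c hg ht), ← Finset.sum_sub_distrib]
  exact Finset.sum_congr rfl fun i _ => by rw [jumpAt, mul_sub]

end IsStepPath

open Classical in
/-- A measure with unit atoms that is carried by a finite set, off a null set, is a sum of Dirac
measures. -/
lemma restrict_eq_sum_dirac {E : Type*} [MeasurableSpace E] [MeasurableSingletonClass E]
    {μ : Measure E} {F : Finset E} (hone : ∀ p ∈ F, μ {p} = 1) {W : Set E}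
    (hnull : μ (W \ F) = 0) :
    μ.restrict W = ∑ p ∈ F with p ∈ W, Measure.dirac p := by
  have hW : W =ᵐ[μ] ((F.filter (· ∈ W) : Finset E) : Set E) := by
    rw [Finset.coe_filter]
    refine (ae_le_set.2 ?_).antisymm (ae_le_set.2 ?_)
    · refine measure_mono_null ?_ hnull
      exact fun p hp => ⟨hp.1, fun h => hp.2 ⟨h, hp.1⟩⟩
    · convert measure_empty (μ := μ)
      exact Set.eq_empty_of_forall_notMem fun p hp => hp.2 hp.1.2
  rw [Measure.restrict_congr_set hW]
  ext B hB
  rw [Measure.restrict_apply hB, Measure.finsetSum_apply]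
  have h1 : B ∩ ((F.filter (· ∈ W) : Finset E) : Set E) =
      (((F.filter (· ∈ W)).filter (· ∈ B) : Finset E) : Set E) := by
    ext p
    simp [and_comm]
  rw [h1, ← sum_measure_singleton, Finset.sum_filter]
  refine Finset.sum_congr rfl fun p hp => ?_
  rw [Measure.dirac_apply' _ hB]
  by_cases hpB : p ∈ B
  · rw [if_pos hpB, Set.indicator_of_mem hpB, hone p (Finset.mem_filter.1 hp).1]
    rfl
  · rw [if_neg hpB, Set.indicator_of_notMem hpB]

section Representation

variable {Ω : Type*} {N : Ω → Measure (ℤ × ℝ × ℝ)} {A : Set (ℝ × ℝ)} {ω : Ω}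
  {F : Finset (ℤ × ℝ × ℝ)} {t : ℝ} (hone : ∀ p ∈ F, N ω {p} = 1)
  (hnull : N ω (Set.univ ×ˢ trawlAt A t \ F) = 0)

include hone hnull

lemma integrableOn_of_carrier :
    IntegrableOn (fun p : ℤ × ℝ × ℝ => (p.1 : ℝ)) (Set.univ ×ˢ trawlAt A t) (N ω) := by
  classical
  rw [IntegrableOn, restrict_eq_sum_dirac hone hnull, integrable_finsetSum_measure]
  exact fun p _ => integrable_dirac (by simp)

lemma trawlProcess_of_carrier :
    trawlProcess N A ω t = ∑ p ∈ F, (p.1 : ℝ) * presence A p.2 t := by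
  classical
  rw [trawlProcess, levyBasis, restrict_eq_sum_dirac hone hnull,
    integral_finsetSum_measure fun p _ => integrable_dirac (by simp), Finset.sum_filter]
  refine Finset.sum_congr rfl fun p _ => ?_
  rw [integral_dirac, presence]
  by_cases h : p.2 ∈ trawlAt A t <;> simp [h]

/-- Stated in `ℝ≥0∞` so that it also yields finiteness, which `toReal` in `trawlCount` would hide.
-/
lemma measure_singleton_prod_of_carrier (k : ℤ) : N ω ({k} ×ˢ trawlAt A t) =
    ENNReal.ofReal (∑ p ∈ F, (if p.1 = k then 1 else 0) * presence A p.2 t) := by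
  classical
  have hm : MeasurableSet (({k} : Set ℤ) ×ˢ (Set.univ : Set (ℝ × ℝ))) :=
    (measurableSet_singleton k).prod MeasurableSet.univ
  have h1 : N ω ({k} ×ˢ trawlAt A t) =
      (N ω).restrict (Set.univ ×ˢ trawlAt A t) ({k} ×ˢ Set.univ) := by
    rw [Measure.restrict_apply hm, Set.prod_inter_prod, Set.inter_univ, Set.univ_inter]
  have hpres : ∀ z, 0 ≤ presence A z t := fun z => Set.indicator_nonneg (fun _ _ => zero_le_one) z
  rw [h1, restrict_eq_sum_dirac hone hnull, Measure.finsetSum_apply, Finset.sum_filter,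
    ENNReal.ofReal_sum_of_nonneg fun p _ => mul_nonneg (by split_ifs <;> norm_num) (hpres _)]
  refine Finset.sum_congr rfl fun p _ => ?_
  rw [Measure.dirac_apply' _ hm, presence, Set.indicator_apply, Set.indicator_apply]
  simp only [Set.mem_prod, Set.mem_univ, true_and, and_true, Set.mem_singleton_iff, Pi.one_apply]
  split_ifs <;> simp

lemma trawlCount_of_carrier (k : ℤ) : trawlCount N A k ω t =
    ∑ p ∈ F, (if p.1 = k then 1 else 0) * presence A p.2 t := by
  rw [trawlCount, measure_singleton_prod_of_carrier hone hnull, ENNReal.toReal_ofReal]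
  exact Finset.sum_nonneg fun p _ => mul_nonneg (by split_ifs <;> norm_num)
    (Set.indicator_nonneg (fun _ _ => zero_le_one) _)

end Representation

/-! ### Regular realizations and the identification of jumps. -/

/-- A realization of the point process for which the trawl process is a piecewise constant path
whose jumps come from single events of positive size. -/
structure IsRegularRealization (μ : Measure (ℤ × ℝ × ℝ)) (A : Set (ℝ × ℝ)) (G : Set ℝ) : Prop where
  regular : ∀ x ∈ G, IsRegularHeight A x
  measurable_swept : ∀ n, MeasurableSet (sweptSet A G n)
  integer_valued : ∀ B, MeasurableSet B → ∃ k : ℕ∞, μ B = (k : ℝ≥0∞)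
  swept_ne_top : ∀ n, μ (sweptSet A G n) ≠ ⊤
  height_mem : μ {p | p.2.1 ∉ G} = 0
  simple : ∀ p, μ {p} ≠ 0 → μ {p} = 1
  disjoint : ∀ p q, μ {p} ≠ 0 → μ {q} ≠ 0 → p.2.1 ∈ G → q.2.1 ∈ G → p ≠ q →
    ∀ t, 0 < t → t ∈ switchTimes A p.2 → t ∉ switchTimes A q.2
  pos : ∀ n p, p ∈ sweptSet A G n → μ {p} ≠ 0 → 0 < p.1
  exists_free : ∀ k : ℤ, ∃ t : ℝ, 0 ≤ t ∧ μ ({k} ×ˢ trawlAt A t) = 0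

/-- A finite set of events that determines the trawl on `[0, n)`. -/
structure IsCarrier (μ : Measure (ℤ × ℝ × ℝ)) (A : Set (ℝ × ℝ)) (n : ℕ)
    (F : Finset (ℤ × ℝ × ℝ)) : Prop where
  one : ∀ p ∈ F, μ {p} = 1
  pos : ∀ p ∈ F, 0 < p.1
  regular : ∀ p ∈ F, IsRegularHeight A p.2.1
  disjoint : ∀ p ∈ F, ∀ q ∈ F, p ≠ q → ∀ t, 0 < t →
    t ∈ switchTimes A p.2 → t ∉ switchTimes A q.2
  null : ∀ t : ℝ, 0 ≤ t → t < n → μ (Set.univ ×ˢ trawlAt A t \ F) = 0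

lemma IsRegularRealization.exists_carrier {μ : Measure (ℤ × ℝ × ℝ)} {A : Set (ℝ × ℝ)} {G : Set ℝ}
    (h : IsRegularRealization μ A G) (n : ℕ) : ∃ F, IsCarrier μ A n F := by
  obtain ⟨F, hF, hnull⟩ :=
    exists_finset_carrier h.integer_valued (h.measurable_swept n) (h.swept_ne_top n)
  refine ⟨F, fun p hp => h.simple p (hF p hp).2, fun p hp => h.pos n p (hF p hp).1 (hF p hp).2,
    fun p hp => h.regular _ (hF p hp).1.1, fun p hp q hq => h.disjoint p q (hF p hp).2 (hF q hq).2
      (hF p hp).1.1 (hF q hq).1.1, fun t ht htn => ?_⟩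
  refine measure_mono_null ?_ (measure_union_null h.height_mem hnull)
  rintro p ⟨⟨-, hp⟩, hpF⟩
  by_cases hG : p.2.1 ∈ G
  · exact Or.inr ⟨mem_sweptSet h.regular hG ht htn hp, hpF⟩
  · exact Or.inl hG

/-- With at most one event switching at time `t`, the jump of the number of events of size `k`
is read off from the jump of the weighted sum. -/
lemma IsCarrier.jumpAt_count {μ : Measure (ℤ × ℝ × ℝ)} {A : Set (ℝ × ℝ)} {n : ℕ}
    {F : Finset (ℤ × ℝ × ℝ)} (hF : IsCarrier μ A n F) {k : ℤ} (hk : 0 < k) {t : ℝ} (ht : 0 < t) :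
    jumpAt (fun t => ∑ p ∈ F, (if p.1 = k then 1 else 0) * presence A p.2 t) t =
      (if jumpAt (fun t => ∑ p ∈ F, (p.1 : ℝ) * presence A p.2 t) t = k then 1 else 0) -
      (if jumpAt (fun t => ∑ p ∈ F, (p.1 : ℝ) * presence A p.2 t) t = ((-k : ℤ) : ℝ)
        then 1 else 0) := by
  have hg : ∀ p ∈ F, IsStepPath (presence A p.2) := fun p hp => (hF.regular p hp).isStepPath
  rw [IsStepPath.jumpAt_sum _ hg ht, IsStepPath.jumpAt_sum _ hg ht]
  have hk0 : (k : ℝ) ≠ 0 := by exact_mod_cast hk.ne'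
  by_cases hex : ∃ p ∈ F, t ∈ switchTimes A p.2
  -- Only `p` can switch at `t`, so both sums reduce to its term. As `p.1` and `k` are positive, an
  -- entry cannot look like a jump by `-k`, nor an exit like a jump by `k`.
  · obtain ⟨p, hp, htp⟩ := hex
    have hz : ∀ q ∈ F, q ≠ p → jumpAt (presence A q.2) t = 0 := fun q hq hqp =>
      jumpAt_presence_eq_zero (hF.disjoint p hp q hq hqp.symm t ht htp)
    rw [Finset.sum_eq_single_of_mem p hp fun q hq hqp => by rw [hz q hq hqp, mul_zero],
      Finset.sum_eq_single_of_mem p hp fun q hq hqp => by rw [hz q hq hqp, mul_zero]]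
    have hp0 := hF.pos p hp
    rcases (hF.regular p hp).jumpAt_presence (z := p.2) t with h | h | h
    · have h2 : (0 : ℝ) ≠ k := hk0.symm
      simp [h, h2, hk.ne']
    · have h2 : (p.1 : ℝ) ≠ -(k : ℝ) := by
        have : p.1 ≠ -k := by lia
        exact_mod_cast this
      simp [h, h2]
    · have h2 : -(p.1 : ℝ) ≠ k := by
        have : -p.1 ≠ k := by lia
        exact_mod_cast this
      simp only [h, mul_neg, mul_one, h2, if_false, Int.cast_neg, neg_inj, Int.cast_inj, zero_sub]
  · have hz : ∀ q ∈ F, jumpAt (presence A q.2) t = 0 := fun q hq =>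
      jumpAt_presence_eq_zero fun h => hex ⟨q, hq, h⟩
    rw [Finset.sum_eq_zero fun q hq => by rw [hz q hq, mul_zero],
      Finset.sum_eq_zero fun q hq => by rw [hz q hq, mul_zero]]
    simp [hk.ne', hk0.symm]

section Realization

variable {Ω : Type*} {N : Ω → Measure (ℤ × ℝ × ℝ)} {A : Set (ℝ × ℝ)} {ω : Ω} {G : Set ℝ}

namespace IsCarrier

variable {n : ℕ} {F : Finset (ℤ × ℝ × ℝ)} (hF : IsCarrier (N ω) A n F)

include hF

lemma trawlProcess_eq {t : ℝ} (ht : 0 ≤ t) (htn : t < n) :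
    trawlProcess N A ω t = ∑ p ∈ F, (p.1 : ℝ) * presence A p.2 t :=
  trawlProcess_of_carrier hF.one (hF.null t ht htn)

lemma trawlCount_eq (k : ℤ) {t : ℝ} (ht : 0 ≤ t) (htn : t < n) :
    trawlCount N A k ω t = ∑ p ∈ F, (if p.1 = k then 1 else 0) * presence A p.2 t :=
  trawlCount_of_carrier hF.one (hF.null t ht htn) k

lemma isStepPath_sum (c : ℤ × ℝ × ℝ → ℝ) :
    IsStepPath (fun t => ∑ p ∈ F, c p * presence A p.2 t) :=
  IsStepPath.sum c fun p hp => (hF.regular p hp).isStepPath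

end IsCarrier

namespace IsRegularRealization

variable (h : IsRegularRealization (N ω) A G)

include h

lemma isStepPath_trawl : IsStepPath (trawlProcess N A ω) :=
  IsStepPath.of_eq_on_bounded fun n => by
    obtain ⟨F, hF⟩ := h.exists_carrier n
    exact ⟨_, hF.isStepPath_sum _, fun t ht htn => hF.trawlProcess_eq ht htn⟩

lemma isStepPath_trawlCount (k : ℤ) : IsStepPath (trawlCount N A k ω) :=
  IsStepPath.of_eq_on_bounded fun n => by
    obtain ⟨F, hF⟩ := h.exists_carrier n
    exact ⟨_, hF.isStepPath_sum _, fun t ht htn => hF.trawlCount_eq k ht htn⟩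

lemma jumpAt_trawlCount {k : ℤ} (hk : 0 < k) {t : ℝ} (ht : 0 < t) :
    jumpAt (trawlCount N A k ω) t = (if jumpAt (trawlProcess N A ω) t = k then 1 else 0) -
      (if jumpAt (trawlProcess N A ω) t = ((-k : ℤ) : ℝ) then 1 else 0) := by
  obtain ⟨n, hn⟩ := exists_nat_gt t
  obtain ⟨F, hF⟩ := h.exists_carrier n
  have hC := jumpAt_congr ((hF.isStepPath_sum fun p => if p.1 = k then 1 else 0).left t ht)
    (f := trawlCount N A k ω)
    (by filter_upwards [Ioo_mem_nhds ht hn] with u hu using hF.trawlCount_eq k hu.1.le hu.2)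
  have hY := jumpAt_congr ((hF.isStepPath_sum fun p => (p.1 : ℝ)).left t ht)
    (f := trawlProcess N A ω)
    (by filter_upwards [Ioo_mem_nhds ht hn] with u hu using hF.trawlProcess_eq hu.1.le hu.2)
  rw [hC, hY, hF.jumpAt_count hk ht]

lemma jumpCount_sub {k : ℤ} (hk : 0 < k) {t : ℝ} (ht : 0 ≤ t) :
    jumpCount (trawlProcess N A ω) (-k) t - jumpCount (trawlProcess N A ω) k t =
      trawlCount N A k ω 0 - trawlCount N A k ω t :=
  jumpCount_sub_jumpCount h.isStepPath_trawl (h.isStepPath_trawlCount k) hk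
    (fun _ hs => h.jumpAt_trawlCount hk hs) ht

/-- The sizes occurring in a finite carrier serve as `K`; grouping the carrier by size turns the sum
over events into a sum over sizes. -/
lemma exists_initial_support : ∃ K : Finset ℤ, (∀ k ∈ K, 0 < k) ∧
    (∀ k : ℤ, 0 < k → k ∉ K → trawlCount N A k ω 0 = 0) ∧
    trawlProcess N A ω 0 = ∑ k ∈ K, (k : ℝ) * trawlCount N A k ω 0 := by
  obtain ⟨F, hF⟩ := h.exists_carrier 1
  have h1 : (0 : ℝ) < (1 : ℕ) := by norm_num
  refine ⟨F.image Prod.fst, ?_, ?_, ?_⟩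
  · intro k hk
    obtain ⟨p, hp, rfl⟩ := Finset.mem_image.1 hk
    exact hF.pos p hp
  · intro k _ hk
    rw [hF.trawlCount_eq k le_rfl h1]
    refine Finset.sum_eq_zero fun p hp => ?_
    rw [if_neg, zero_mul]
    rintro rfl
    exact hk (Finset.mem_image_of_mem _ hp)
  · have hterm : ∀ k ∈ F.image Prod.fst, (k : ℝ) * trawlCount N A k ω 0 =
        ∑ p ∈ F, (k : ℝ) * ((if p.1 = k then 1 else 0) * presence A p.2 0) := fun k _ => by
      rw [hF.trawlCount_eq k le_rfl h1, Finset.mul_sum]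
    rw [hF.trawlProcess_eq le_rfl h1, Finset.sum_congr rfl hterm, Finset.sum_comm]
    refine Finset.sum_congr rfl fun p hp => ?_
    rw [Finset.sum_eq_single_of_mem p.1 (Finset.mem_image_of_mem _ hp)]
    · simp
    · intro k _ hk
      simp [hk.symm]

lemma trawlCount_eq_intCast (hA : MeasurableSet A) (k : ℤ) :
    ∃ m : ℤ, trawlCount N A k ω 0 = m := by
  obtain ⟨j, hj⟩ := h.integer_valued _
    ((measurableSet_singleton k).prod (measurableSet_trawlAt hA 0))
  -- If `j = ⊤`, both `ENat.toNat` and `ENNReal.toReal` give `0`, so the equality holds in that case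
  -- too.
  refine ⟨j.toNat, ?_⟩
  rw [trawlCount, hj]
  induction j using ENat.recTopCoe <;> simp

end IsRegularRealization

end Realization

/-! ### Almost sure regularity and the conclusion. -/

lemma ae_isRegularRealization {Ω : Type*} [MeasurableSpace Ω] {P : Measure Ω}
    [IsProbabilityMeasure P] {ν : Measure ℤ} [IsFiniteMeasure ν] (hν : ν {0} = 0)
    {N : Ω → Measure (ℤ × ℝ × ℝ)} (hN : IsPoissonRandomMeasure N (basisIntensity ν) P)
    {A : Set (ℝ × ℝ)} (hA : IsTrawl A) (hnonneg : ∀ᵐ ω ∂P, 0 ≤ trawlProcess N A ω 0) :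
    ∃ G : Set ℝ, ∀ᵐ ω ∂P, IsRegularRealization (N ω) A G := by
  -- The set of regular heights need not be known to be measurable, so `G` is the complement of a
  -- measurable null set containing all irregular heights.
  obtain ⟨G, hGA, hG, hG0⟩ : ∃ G : Set ℝ, (∀ x ∈ G, IsRegularHeight A x) ∧ MeasurableSet G ∧
      volume Gᶜ = 0 := by
    obtain ⟨B, hB, hBm, hB0⟩ := exists_measurable_superset_of_null (ae_iff.1 hA.section_regular)
    refine ⟨Bᶜ, fun x hx => ?_, hBm.compl, by rwa [compl_compl]⟩
    by_contra hreg
    exact hx (hB hreg)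
  refine ⟨G, ?_⟩
  have hmeas := measurableSet_sweptSet hA.measurableSet hG
  have hfin : ∀ᵐ ω ∂P, ∀ n, N ω (sweptSet A G n) < ⊤ :=
    ae_all_iff.2 fun n => hN.ae_lt_top (hmeas n) (basisIntensity_sweptSet_ne_top hA G n ν)
  have hheight : ∀ᵐ ω ∂P, N ω {p | p.2.1 ∉ G} = 0 := by
    refine hN.ae_eq_zero ((measurable_fst.comp measurable_snd) hG.compl) ?_
    have he : {p : ℤ × ℝ × ℝ | p.2.1 ∉ G} = Set.univ ×ˢ Gᶜ ×ˢ Set.univ := by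
      ext p
      simp
    rw [he]
    refine le_antisymm ((basisIntensity_prod_le ν _ _).trans ?_) (zero_le (a := _))
    rw [Measure.volume_eq_prod, Measure.prod_prod, hG0, zero_mul, mul_zero]
  filter_upwards [hfin, hheight, ae_singleton_eq_one hN,
    ae_disjoint_switchTimes hN hA.measurableSet hG hGA, ae_sweptSet_pos hν hN hA hnonneg G,
    ae_all_iff.2 fun k => ae_exists_count_eq_zero hN hA k] with ω h1 h2 h3 h4 h5 h6
  exact ⟨hGA, hmeas, hN.integer_valued ω, fun n => (h1 n).ne, h2, h3, h4, h5, h6⟩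

theorem mainTheorem4 {Ω : Type*} [MeasurableSpace Ω] (P : Measure Ω) [IsProbabilityMeasure P]
    (ν : Measure ℤ) [IsFiniteMeasure ν] (hν : ν {0} = 0)
    (N : Ω → Measure (ℤ × ℝ × ℝ)) (hN : IsPoissonRandomMeasure N (basisIntensity ν) P)
    (A : Set (ℝ × ℝ)) (hA : IsTrawl A)
    (hnonneg : ∀ᵐ ω ∂P, ∀ t : ℝ, 0 ≤ t → 0 ≤ trawlProcess N A ω t) :
    ∀ᵐ ω ∂P,
      -- the process, its jumps, the jump counts and the hidden counts are well defined
      (∀ t : ℝ, 0 ≤ t →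
        IntegrableOn (fun p : ℤ × ℝ × ℝ => (p.1 : ℝ)) (Set.univ ×ˢ trawlAt A t) (N ω)) ∧
      (∀ t : ℝ, 0 < t → ∃ l : ℝ, Tendsto (trawlProcess N A ω) (𝓝[<] t) (𝓝 l)) ∧
      (∀ T : ℝ, {s | s ∈ Set.Ioc 0 T ∧ jumpAt (trawlProcess N A ω) s ≠ 0}.Finite) ∧
      (∀ y : ℤ, 0 < y → N ω ({y} ×ˢ trawlAt A 0) ≠ ⊤) ∧
      -- the supremum and the sum in the two bounds are well defined
      (∀ T : ℝ, 0 ≤ T → ∀ y : ℤ, 0 < y →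
        BddAbove ((fun t => jumpCount (trawlProcess N A ω) (-y) t
          - jumpCount (trawlProcess N A ω) y t) '' Set.Icc 0 T) ∧
        Summable (fun k : {k : ℤ // 0 < k ∧ k ≠ y} =>
          (k.1 : ℝ) * lowerBound (trawlProcess N A ω) k.1 T)) ∧
      -- the bounds and their convergence
      (∀ y : ℤ, 0 < y →
        (∀ T : ℝ, 0 ≤ T →
          lowerBound (trawlProcess N A ω) y T ≤ trawlCount N A y ω 0 ∧
          trawlCount N A y ω 0 ≤ (upperBound (trawlProcess N A ω) y T : ℝ)) ∧
        Tendsto (fun T : ℝ => lowerBound (trawlProcess N A ω) y T) atTop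
          (𝓝 (trawlCount N A y ω 0)) ∧
        Tendsto (fun T : ℝ => (upperBound (trawlProcess N A ω) y T : ℝ)) atTop
          (𝓝 (trawlCount N A y ω 0))) := by
  obtain ⟨G, hreg⟩ := ae_isRegularRealization hν hN hA (hnonneg.mono fun ω h => h 0 le_rfl)
  filter_upwards [hreg] with ω h
  have hstep := h.isStepPath_trawl
  have hcount : ∀ k : ℤ, 0 < k → ∀ t, 0 ≤ t → jumpCount (trawlProcess N A ω) (-k) t -
      jumpCount (trawlProcess N A ω) k t = trawlCount N A k ω 0 - trawlCount N A k ω t :=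
    fun k hk t ht => h.jumpCount_sub hk ht
  have hnn : ∀ k : ℤ, ∀ t, 0 ≤ t → 0 ≤ trawlCount N A k ω t := fun k t _ => ENNReal.toReal_nonneg
  have hzero : ∀ k : ℤ, 0 < k → ∃ t, 0 ≤ t ∧ trawlCount N A k ω t = 0 := fun k _ => by
    obtain ⟨t, ht, h0⟩ := h.exists_free k
    exact ⟨t, ht, by rw [trawlCount, h0, ENNReal.toReal_zero]⟩
  obtain ⟨K, hKpos, hK, hsum⟩ := h.exists_initial_support
  refine ⟨fun t ht => ?_, fun t ht => hstep.tendsto_left ht, hstep.finite_jumps, fun y _ => ?_,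
    fun T hT y hy => ⟨?_, ?_⟩, fun y hy => ⟨fun T hT => ⟨?_, ?_⟩, ?_, ?_⟩⟩
  · obtain ⟨n, hn⟩ := exists_nat_gt t
    obtain ⟨F, hF⟩ := h.exists_carrier n
    exact integrableOn_of_carrier hF.one (hF.null t ht hn)
  · obtain ⟨F, hF⟩ := h.exists_carrier 1
    rw [measure_singleton_prod_of_carrier hF.one (hF.null 0 le_rfl (by norm_num))]
    exact ENNReal.ofReal_ne_top
  · rw [image_jumpCount_sub hcount hy]
    exact bddAbove_image_sub (hnn y) T
  · exact (hasSum_lowerBound hcount hnn hK hKpos hT).summable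
  · exact lowerBound_le hcount hnn hy T
  · obtain ⟨m, hm⟩ := h.trawlCount_eq_intCast hA.measurableSet y
    exact le_upperBound hcount hnn hK hKpos hsum hy hm hT
  · exact tendsto_const_nhds.congr' ((eventually_lowerBound_eq hcount hnn hzero hy).mono
      fun T hT => hT.symm)
  · obtain ⟨m, hm⟩ := h.trawlCount_eq_intCast hA.measurableSet y
    exact tendsto_const_nhds.congr'
      ((eventually_upperBound_eq hcount hnn hK hKpos hsum hzero hy hm).mono fun T hT => hT.symm)
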